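/- Let $0<\alpha<1$. For $O\subset\mathbb{R}^m$ open, $buc^{k+\alpha}(O)$ is the little Hölder space, that is, the closure of $BUC^{k+\beta}(O)$ ($\alpha<\beta<1$) in $BUC^{k+\alpha}(O)$. Maps on subsets of $\mathbb{R}^m$ are said to be of class $buc^{k+\alpha}$ if, near each point of the subset, they are restrictions of $buc^{k+\alpha}$ maps on open sets; a diffeomorphism of class $buc^{k+\alpha}$ is a bijection which is of this class together with its inverse. Let $\mathcal{M}^{2+\alpha}$ be the set of compact, orientable, embedded hypersurfaces of $\mathbb{R}^n$ of class $buc^{2+\alpha}$. Let $\Gamma_0\in\mathcal{M}^{2+\alpha}$, let $\nu$ be a continuous unit normal field on $\Gamma_0$ (for instance the outward one, if $\Gamma_0$ bounds a domain), and let $T_R(\Gamma_0)=\{x\in\mathbb{R}^n : \operatorname{dist}(x,\Gamma_0)<R\}$. (a) There is $R>0$ such that $(y,r)\mapsto y+r\nu(y)$ is a diffeomorphism of class $buc^{1+\alpha}$ from $\Gamma_0\times(-R,R)$ onto $T_R(\Gamma_0)$. (b) Let $R>0$ be any number as in (a), and denote by $x\mapsto(y(x),r(x))$ the inverse of the diffeomorphism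 in (a). Let $\eta\in C^\infty(\mathbb{R})$ satisfy $0\le\eta\le1$, $\eta=1$ on $[-R/2,R/2]$ and $\eta=0$ outside $(-3R/4,3R/4)$. Let $\psi\in C_c^\infty(\mathbb{R}^n)$ satisfy $\psi\ge0$ and $\int\psi=1$, and put $\psi_\delta(x)=\delta^{-n}\psi(x/\delta)$. Define $\widetilde\nu(x)=\eta(r(x))\,\nu(y(x))$ for $x\in T_R(\Gamma_0)$ and $\widetilde\nu(x)=0$ otherwise, and let $\nu^\delta=\psi_\delta*\widetilde\nu$ (componentwise). Then there are $r_0>0$ and $\delta_0>0$ such that for every $\delta\in(0,\delta_0)$ the following holds. The vector field $\nu^\delta$ is $C^\infty$ and has compact support contained in $T_R(\Gamma_0)$. It has a global flow $\varphi^\delta$ ($\partial_r\varphi^\delta(y,r)=\nu^\delta(\varphi^\delta(y,r))$, $\varphi^\delta(y,0)=y$), and the sets $\Gamma_r=\varphi^\delta(\Gamma_0,r)$ satisfy: 1. $\Gamma_r\subset T_R(\Gamma_0)$ for $|r|\le r_0$; 2. $\Gamma_r\in\mathcal{M}^{2+\alpha}$ for $|r|<r_0$; 3. the $\Gamma_r$,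 $|r|<r_0$, are pairwise disjoint, and $\bigcup_{|r|<r_0}\Gamma_r$ is an open neighborhood of $\Gamma_0$; 4. $\varphi^\delta$ restricts to a diffeomorphism of class $buc^{2+\alpha}$ from $\Gamma_0\times(-r_0,r_0)$ onto $\bigcup_{|r|<r_0}\Gamma_r$. -/

import Mathlib

open Set Metric MeasureTheory
open scoped ContDiff Convolution

section HolderSpaces

variable {E F : Type*} [NormedAddCommGroup E] [NormedSpace ℝ E]
  [NormedAddCommGroup F] [NormedSpace ℝ F]

/-- `f` is of class `C^k` on the open set `O` and its `C^{k+α}` norm on `O`, measured by the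
suprema of all derivatives of order at most `k` and the `α`-Hölder seminorm of the derivative of
order `k`, is at most `C`. The suprema are combined by a maximum, which gives a norm equivalent to
the one in which the seminorm is added. -/
def HolderNormLE (k : ℕ) (α : ℝ) (f : E → F) (O : Set E) (C : ℝ) : Prop :=
  ContDiffOn ℝ k f O ∧
  (∀ i ≤ k, ∀ x ∈ O, ‖iteratedFDeriv ℝ i f x‖ ≤ C) ∧
  ∀ x ∈ O, ∀ y ∈ O, ‖iteratedFDeriv ℝ k f x - iteratedFDeriv ℝ k f y‖ ≤ C * dist x y ^ α

/-- The space `BUC^{k+β}(O)`: all derivatives of order at most `k` exist and are bounded and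
uniformly continuous on the open set `O`, and those of order `k` are uniformly `β`-Hölder. -/
def IsBUC (k : ℕ) (β : ℝ) (f : E → F) (O : Set E) : Prop :=
  (∀ i ≤ k, UniformContinuousOn (iteratedFDeriv ℝ i f) O) ∧ ∃ C, HolderNormLE k β f O C

/-- The little Hölder space `buc^{k+α}(O)`: the closure of `BUC^{k+β}(O)`, `α < β < 1`, in
`BUC^{k+α}(O)` with respect to the norm of the latter. -/
def IsLittleHolder (k : ℕ) (α : ℝ) (f : E → F) (O : Set E) : Prop :=
  IsBUC k α f O ∧
  ∃ β, α < β ∧ β < 1 ∧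
    ∀ ε > 0, ∃ g : E → F, IsBUC k β g O ∧ HolderNormLE k α (fun x => f x - g x) O ε

/-- A map on a subset `S` (an open set, a compact hypersurface, or a product of such a hypersurface
with an open interval) is of class `buc^{k+α}` in the localized sense: near every point of `S` it is
the restriction to `S` of a `buc^{k+α}` map on an open set of the ambient space. -/
def LittleHolderOnSet (k : ℕ) (α : ℝ) (Φ : E → F) (S : Set E) : Prop :=
  ∀ x ∈ S, ∃ W : Set E, IsOpen W ∧ x ∈ W ∧
    ∃ f : E → F, IsLittleHolder k α f W ∧ EqOn Φ f (S ∩ W)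

/-- `Φ` restricts to a diffeomorphism of class `buc^{k+α}` of `S` onto `T`. -/
def IsLittleHolderDiffeo (k : ℕ) (α : ℝ) (Φ : E → F) (S : Set E) (T : Set F) : Prop :=
  BijOn Φ S T ∧ LittleHolderOnSet k α Φ S ∧
    ∃ Ψ : F → E, InvOn Ψ Φ S T ∧ LittleHolderOnSet k α Ψ T

end HolderSpaces

section Hypersurfaces

variable {n : ℕ}

/-- A continuous field of unit normal vectors along `Γ` (an orientation of `Γ`); for a `C^1`
hypersurface the tangent cone is the tangent space. Only the values of `ν` on `Γ` matter. -/
def IsUnitNormalField (Γ : Set (EuclideanSpace ℝ (Fin n)))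
    (ν : EuclideanSpace ℝ (Fin n) → EuclideanSpace ℝ (Fin n)) : Prop :=
  ContinuousOn ν Γ ∧ ∀ y ∈ Γ, ‖ν y‖ = 1 ∧ ∀ v ∈ tangentConeAt ℝ Γ y, inner ℝ (ν y) v = 0

/-- The set `𝓜^{k+α}`, for `k ≥ 1`, of compact orientable embedded hypersurfaces of `ℝⁿ` of class
`buc^{k+α}`: near each of its points `Γ` is a regular level set of a `buc^{k+α}` function. -/
def hypersurfaces (n k : ℕ) (α : ℝ) : Set (Set (EuclideanSpace ℝ (Fin n))) :=
  {Γ | IsCompact Γ ∧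
    (∀ x ∈ Γ, ∃ W : Set (EuclideanSpace ℝ (Fin n)), IsOpen W ∧ x ∈ W ∧
      ∃ f : EuclideanSpace ℝ (Fin n) → ℝ, IsLittleHolder k α f W ∧
        (∀ z ∈ W, fderiv ℝ f z ≠ 0) ∧ Γ ∩ W = {z ∈ W | f z = 0}) ∧
    ∃ ν, IsUnitNormalField Γ ν}

/-- The normal coordinate map `(y, r) ↦ y + r ν(y)`. -/
def normalMap (ν : EuclideanSpace ℝ (Fin n) → EuclideanSpace ℝ (Fin n))
    (p : EuclideanSpace ℝ (Fin n) × ℝ) : EuclideanSpace ℝ (Fin n) :=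
  p.1 + p.2 • ν p.1

/-- `R` is the radius of a tubular neighbourhood `T_R(Γ) = {x | d(x, Γ) < R}` of `Γ`: the normal
coordinate map is a diffeomorphism of class `buc^{1+α}` from `Γ × (-R, R)` onto `T_R(Γ)`. -/
def IsTubularRadius (α : ℝ) (Γ : Set (EuclideanSpace ℝ (Fin n)))
    (ν : EuclideanSpace ℝ (Fin n) → EuclideanSpace ℝ (Fin n)) (R : ℝ) : Prop :=
  0 < R ∧ IsLittleHolderDiffeo 1 α (normalMap ν) (Γ ×ˢ Ioo (-R) R) (thickening R Γ)

/-- The coordinates `(y(x), r(x))` of `x ∈ T_R(Γ)`, with `x = y(x) + r(x) ν(y(x))`. -/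
noncomputable def tubeCoord (Γ : Set (EuclideanSpace ℝ (Fin n)))
    (ν : EuclideanSpace ℝ (Fin n) → EuclideanSpace ℝ (Fin n)) (R : ℝ) :
    EuclideanSpace ℝ (Fin n) → EuclideanSpace ℝ (Fin n) × ℝ :=
  Function.invFunOn (normalMap ν) (Γ ×ˢ Ioo (-R) R)

/-- A smooth cut-off function: `0 ≤ η ≤ 1`, `η = 1` on `[-R/2, R/2]`, and `η = 0` outside
`(-3R/4, 3R/4)`. -/
structure IsCutoff (R : ℝ) (η : ℝ → ℝ) : Prop where
  smooth : ContDiff ℝ ∞ η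
  nonneg : ∀ r, 0 ≤ η r
  le_one : ∀ r, η r ≤ 1
  eq_one : ∀ r ∈ Icc (-(R / 2)) (R / 2), η r = 1
  eq_zero : ∀ r ∉ Ioo (-(3 * R / 4)) (3 * R / 4), η r = 0

open Classical in
/-- The normal field extended to `T_R(Γ)` constantly along normals, cut off by `η`, and extended by
zero to `ℝⁿ`. -/
noncomputable def cutoffNormal (Γ : Set (EuclideanSpace ℝ (Fin n)))
    (ν : EuclideanSpace ℝ (Fin n) → EuclideanSpace ℝ (Fin n)) (R : ℝ) (η : ℝ → ℝ)
    (x : EuclideanSpace ℝ (Fin n)) : EuclideanSpace ℝ (Fin n) :=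
  if x ∈ thickening R Γ then η (tubeCoord Γ ν R x).2 • ν (tubeCoord Γ ν R x).1 else 0

/-- A compactly supported smooth mollifier. -/
structure IsMollifier (ψ : EuclideanSpace ℝ (Fin n) → ℝ) : Prop where
  smooth : ContDiff ℝ ∞ ψ
  compactSupport : HasCompactSupport ψ
  nonneg : ∀ x, 0 ≤ ψ x
  integral_eq_one : ∫ x, ψ x = 1

/-- The rescaled mollifier `ψ_δ(x) = δ^{-n} ψ(x / δ)`. -/
noncomputable def rescale (ψ : EuclideanSpace ℝ (Fin n) → ℝ) (δ : ℝ)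
    (x : EuclideanSpace ℝ (Fin n)) : ℝ :=
  (δ ^ n)⁻¹ * ψ (δ⁻¹ • x)

/-- The regularized normal field `ν^δ`: the componentwise convolution of `ψ_δ` with the cut-off
extension of the normal field. -/
noncomputable def regularizedNormal (Γ : Set (EuclideanSpace ℝ (Fin n)))
    (ν : EuclideanSpace ℝ (Fin n) → EuclideanSpace ℝ (Fin n)) (R : ℝ) (η : ℝ → ℝ)
    (ψ : EuclideanSpace ℝ (Fin n) → ℝ) (δ : ℝ) :
    EuclideanSpace ℝ (Fin n) → EuclideanSpace ℝ (Fin n) :=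
  rescale ψ δ ⋆[ContinuousLinearMap.lsmul ℝ ℝ, volume] cutoffNormal Γ ν R η

/-- `φ` is the global flow of the vector field `v`: `r ↦ φ y r` solves `x' = v(x)`, `x(0) = y`. -/
def IsFlowOf (v : EuclideanSpace ℝ (Fin n) → EuclideanSpace ℝ (Fin n))
    (φ : EuclideanSpace ℝ (Fin n) → ℝ → EuclideanSpace ℝ (Fin n)) : Prop :=
  ∀ y, φ y 0 = y ∧ ∀ r, HasDerivAt (φ y) (v (φ y r)) r

end Hypersurfaces

/-! The little Hölder spaces are replaced by a pointwise condition: `BucAt k α f x` asks for `C^k`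
near `x` and for the `k`-th derivative to have increments `o(|y - z|^α)` at all points near `x`. In
finite dimensions this is what `buc^{k+α}` means locally. A limit of `BUC^{k+β}` functions with `β >
α` has such increments (`IsLittleHolder.bucAt`); conversely, a compactly supported function with
such increments is approximated in the `C^{k+α}` norm by its mollifications
(`exists_contDiff_holderNormLE_sub`). Products, compositions and the inverse function theorem then
follow by induction on `k`.

For (a), the unit normal is locally a fixed sign times a normalized gradient, hence of class
`buc^{1+α}`. If `f` defines `Γ` near `y`, the inverse function theorem applies to `(z, r) ↦ (z + r
ν(z), f z)`, and the slice over `f = 0` inverts the normal map without charts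
(`exists_local_inverse_on_levelSet`). A Lebesgue number makes this uniform over `Γ`, and nearest
points give surjectivity.

For (b), the mollified field is smooth, so its flow is smooth (`IsGlobalFlow.contDiff`), and its
time-`r` maps carry `Γ₀` to hypersurfaces of the same class. The mollified field is uniformly close
to the cut-off normal, along which the normal coordinate `r(x)` grows at unit speed near `Γ₀`. Hence
the field is transversal to `Γ₀`, and `r(x)` increases strictly along short orbits starting on `Γ₀`,
which therefore cannot return. Transversality gives local `buc^{2+α}` inverses of the flow map on
`Γ₀ × ℝ`, and non-return gives injectivity and disjointness (`flow_tube`). All bounds that determine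
`r₀` come from the normal coordinate alone, so `r₀` does not depend on `δ`. -/

/-! ### Calculus of germs of little Hölder maps. -/

section LittleHolderGerms

set_option linter.unusedSectionVars false

open Filter Asymptotics Topology

variable {E F G H : Type} [NormedAddCommGroup E] [NormedSpace ℝ E]
  [NormedAddCommGroup F] [NormedSpace ℝ F] [NormedAddCommGroup G] [NormedSpace ℝ G]
  [NormedAddCommGroup H] [NormedSpace ℝ H]

/-- `f y - f z = o(|y - z| ^ α)` as `y, z → x`. -/
def LittleHolderAt (α : ℝ) (f : E → F) (x : E) : Prop :=
  (fun p : E × E => f p.1 - f p.2) =o[𝓝 (x, x)] fun p => dist p.1 p.2 ^ α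

/-- `f` is of class `C^k` near `x`, and its derivative of order `k` satisfies the little
`α`-Hölder condition at all points near `x`. -/
def BucAt (k : ℕ) (α : ℝ) (f : E → F) (x : E) : Prop :=
  ContDiffAt ℝ k f x ∧ ∀ᶠ y in 𝓝 x, LittleHolderAt α (iteratedFDeriv ℝ k f) y

variable {α : ℝ} {k : ℕ} {f : E → F} {x : E}

theorem eventually_nhds_prod_self {p : E → Prop} (h : ∀ᶠ y in 𝓝 x, p y) :
    ∀ᶠ q : E × E in 𝓝 (x, x), p q.1 ∧ p q.2 := by
  rw [nhds_prod_eq]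
  exact h.prod_mk h

theorem LittleHolderAt.congr {g : E → F} (h : LittleHolderAt α f x) (hfg : f =ᶠ[𝓝 x] g) :
    LittleHolderAt α g x := by
  refine IsLittleO.congr' h ?_ EventuallyEq.rfl
  filter_upwards [eventually_nhds_prod_self hfg] with p hp
  rw [hp.1, hp.2]

theorem littleHolderAt_iff_of_dist_eq {g : E → G} (h : ∀ y z, dist (f y) (f z) = dist (g y) (g z)) :
    LittleHolderAt α f x ↔ LittleHolderAt α g x := by
  unfold LittleHolderAt
  rw [← isLittleO_norm_left, ← isLittleO_norm_left (f' := fun p : E × E => g p.1 - g p.2)]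
  simp only [← dist_eq_norm, h]

theorem LittleHolderAt.clm_comp (L : F →L[ℝ] G) (h : LittleHolderAt α f x) :
    LittleHolderAt α (fun y => L (f y)) x := by
  refine IsBigO.trans_isLittleO (g := fun p : E × E => f p.1 - f p.2) ?_ h
  simp only [← map_sub]
  exact L.isBigO_comp _ _

theorem LittleHolderAt.prodMk {g : E → G} (hf : LittleHolderAt α f x)
    (hg : LittleHolderAt α g x) : LittleHolderAt α (fun y => (f y, g y)) x := by
  simpa [LittleHolderAt] using! IsLittleO.prod_left hf hg

theorem LittleHolderAt.continuousAt (hα : 0 < α) (h : LittleHolderAt α f x) :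
    ContinuousAt f x := by
  have h1 : Tendsto (fun p : E × E => dist p.1 p.2 ^ α) (𝓝 (x, x)) (𝓝 0) := by
    have : Continuous fun p : E × E => dist p.1 p.2 ^ α :=
      (continuous_fst.dist continuous_snd).rpow_const fun _ => Or.inr hα.le
    simpa [Real.zero_rpow hα.ne'] using this.tendsto (x, x)
  have h2 := (IsLittleO.isBigO h).trans_tendsto h1
  have h3 : Tendsto (fun y => (y, x)) (𝓝 x) (𝓝 (x, x)) := by
    exact (Continuous.prodMk_left x).tendsto x
  exact tendsto_sub_nhds_zero_iff.1 (h2.comp h3)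

theorem isLittleO_sub_dist_rpow (hα₁ : α < 1) (x : E) :
    (fun p : E × E => p.1 - p.2) =o[𝓝 (x, x)] fun p => dist p.1 p.2 ^ α := by
  have hβ : 0 < 1 - α := by linarith
  have h1 : Tendsto (fun p : E × E => dist p.1 p.2 ^ (1 - α)) (𝓝 (x, x)) (𝓝 0) := by
    have : Continuous fun p : E × E => dist p.1 p.2 ^ (1 - α) :=
      (continuous_fst.dist continuous_snd).rpow_const fun _ => Or.inr hβ.le
    simpa [Real.zero_rpow hβ.ne'] using this.tendsto (x, x)
  rw [isLittleO_iff]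
  intro c hc
  filter_upwards [h1.eventually (gt_mem_nhds hc)] with p hp
  rw [← dist_eq_norm, Real.norm_of_nonneg (by positivity)]
  rcases eq_or_lt_of_le (dist_nonneg (x := p.1) (y := p.2)) with h0 | h0
  · rw [← h0]; positivity
  calc dist p.1 p.2 = dist p.1 p.2 ^ (1 - α) * dist p.1 p.2 ^ α := by
        rw [← Real.rpow_add h0]; simp
    _ ≤ c * dist p.1 p.2 ^ α := by gcongr

theorem LittleHolderAt.of_contDiffAt (hα₁ : α < 1) (h : ContDiffAt ℝ 1 f x) :
    LittleHolderAt α f x :=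
  (h.hasStrictFDerivAt one_ne_zero).isBigO_sub.trans_isLittleO (isLittleO_sub_dist_rpow hα₁ x)

theorem LittleHolderAt.comp (hα₀ : 0 < α) {g : F → G} (hg : LittleHolderAt α g (f x))
    (hf : ContDiffAt ℝ 1 f x) : LittleHolderAt α (fun y => g (f y)) x := by
  have hf' := hf.hasStrictFDerivAt one_ne_zero
  have h1 : Tendsto (fun p : E × E => (f p.1, f p.2)) (𝓝 (x, x)) (𝓝 (f x, f x)) := by
    rw [nhds_prod_eq, nhds_prod_eq]
    exact hf.continuousAt.tendsto.prodMap hf.continuousAt.tendsto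
  refine (IsLittleO.comp_tendsto hg h1).trans_isBigO ?_
  refine IsBigO.rpow hα₀.le (Eventually.of_forall fun _ => dist_nonneg) ?_
  simp only [dist_eq_norm]
  exact hf'.isBigO_sub.norm_norm

/-- Telescoping splits the increment into two terms, each a small increment times a factor that
stays bounded by continuity. -/
theorem LittleHolderAt.bilinear (hα₀ : 0 < α) {g : E → G} (B : F →L[ℝ] G →L[ℝ] H)
    (hf : LittleHolderAt α f x) (hg : LittleHolderAt α g x) :
    LittleHolderAt α (fun y => B (f y) (g y)) x := by
  have hfc := hf.continuousAt hα₀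
  have hgc := hg.continuousAt hα₀
  have e : (fun p : E × E => B (f p.1) (g p.1) - B (f p.2) (g p.2)) =
      fun p => B (f p.1 - f p.2) (g p.1) + B (f p.2) (g p.1 - g p.2) := by
    ext p; simp
  have hgb : (fun p : E × E => g p.1) =O[𝓝 (x, x)] fun _ => (1 : ℝ) :=
    (Tendsto.comp (x := 𝓝 (x, x)) hgc.tendsto continuous_fst.continuousAt).isBigO_one ℝ
  have hfb : (fun p : E × E => f p.2) =O[𝓝 (x, x)] fun _ => (1 : ℝ) :=
    (Tendsto.comp (x := 𝓝 (x, x)) hfc.tendsto continuous_snd.continuousAt).isBigO_one ℝ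
  unfold LittleHolderAt
  rw [e]
  refine IsLittleO.add ?_ ?_
  · refine IsBigO.trans_isLittleO (g := fun p : E × E => ‖f p.1 - f p.2‖ * ‖g p.1‖) ?_ ?_
    · exact IsBigO.of_bound ‖B‖ (Eventually.of_forall fun p => by
        simpa [mul_assoc] using B.le_opNorm₂ (f p.1 - f p.2) (g p.1))
    · simpa using! (IsLittleO.norm_left hf).mul_isBigO hgb.norm_left
  · refine IsBigO.trans_isLittleO (g := fun p : E × E => ‖f p.2‖ * ‖g p.1 - g p.2‖) ?_ ?_
    · exact IsBigO.of_bound ‖B‖ (Eventually.of_forall fun p => by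
        simpa [mul_assoc] using B.le_opNorm₂ (f p.2) (g p.1 - g p.2))
    · simpa using! hfb.norm_left.mul_isLittleO (IsLittleO.norm_left hg)

theorem BucAt.congr {g : E → F} (h : BucAt k α f x) (hfg : f =ᶠ[𝓝 x] g) : BucAt k α g x := by
  refine ⟨h.1.congr_of_eventuallyEq hfg.symm, ?_⟩
  filter_upwards [h.2, hfg.eventually_nhds] with y hy hy'
  exact hy.congr (EventuallyEq.iteratedFDeriv ℝ (f₁ := f) (f₂ := g) hy' k)

theorem BucAt.eventually (h : BucAt k α f x) : ∀ᶠ y in 𝓝 x, BucAt k α f y :=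
  (h.1.eventually (by simp)).and h.2.eventually_nhds

theorem bucAt_zero_iff (hα₀ : 0 < α) :
    BucAt 0 α f x ↔ ∀ᶠ y in 𝓝 x, LittleHolderAt α f y := by
  have e : ∀ y, LittleHolderAt α (iteratedFDeriv ℝ 0 f) y ↔ LittleHolderAt α f y := fun y =>
    littleHolderAt_iff_of_dist_eq fun y z => by
      simp only [iteratedFDeriv_zero_eq_comp, Function.comp_apply]
      exact (continuousMultilinearCurryFin0 ℝ E F).symm.dist_map _ _
  unfold BucAt
  simp only [e]
  refine ⟨fun h => h.2, fun h => ⟨?_, h⟩⟩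
  obtain ⟨u, hu, hu'⟩ := eventually_iff_exists_mem.1 h
  simp only [CharP.cast_eq_zero, contDiffAt_zero]
  exact ⟨u, hu, fun y hy => ((hu' y hy).continuousAt hα₀).continuousWithinAt⟩

/-- Currying is an isometry, so the increments of the derivative of order `k + 1` are those of the
`k`-th derivative of `fderiv ℝ f`. This recursion drives all the inductions on `k` below. -/
theorem bucAt_succ_iff :
    BucAt (k + 1) α f x ↔
      (∀ᶠ y in 𝓝 x, DifferentiableAt ℝ f y) ∧ BucAt k α (fderiv ℝ f) x := by
  have e' : ∀ y, LittleHolderAt α (iteratedFDeriv ℝ (k + 1) f) y ↔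
      LittleHolderAt α (iteratedFDeriv ℝ k (fderiv ℝ f)) y := fun y =>
    littleHolderAt_iff_of_dist_eq fun y z => by
      rw [iteratedFDeriv_succ_eq_comp_right, iteratedFDeriv_succ_eq_comp_right]
      exact (continuousMultilinearCurryRightEquiv' ℝ k E F).symm.dist_map _ _
  unfold BucAt
  simp only [e', ← and_assoc]
  refine and_congr_left fun _ => ?_
  push_cast
  rw [contDiffAt_succ_iff_hasFDerivAt]
  constructor
  · rintro ⟨f', ⟨u, hu, hf⟩, hf'⟩
    refine ⟨mem_of_superset hu fun y hy => (hf y hy).differentiableAt, ?_⟩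
    exact hf'.congr_of_eventuallyEq (mem_of_superset hu fun y hy => (hf y hy).fderiv)
  · rintro ⟨h1, h2⟩
    exact ⟨_, ⟨_, h1, fun y hy => DifferentiableAt.hasFDerivAt hy⟩, h2⟩

theorem BucAt.of_contDiffAt (hα₀ : 0 < α) (hα₁ : α < 1) (h : ContDiffAt ℝ (k + 1 : ℕ) f x) :
    BucAt k α f x := by
  induction k generalizing F with
  | zero =>
    rw [bucAt_zero_iff hα₀]
    filter_upwards [h.eventually (by simp)] with y hy
    exact LittleHolderAt.of_contDiffAt hα₁ (by simpa using hy)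
  | succ k ih =>
    rw [bucAt_succ_iff]
    refine ⟨?_, ih (h.fderiv_right (by norm_cast))⟩
    filter_upwards [h.eventually (by simp)] with y hy
    exact hy.differentiableAt (by simp)

theorem BucAt.of_contDiffAt_infty (hα₀ : 0 < α) (hα₁ : α < 1) (h : ContDiffAt ℝ ∞ f x) :
    BucAt k α f x :=
  .of_contDiffAt hα₀ hα₁ (h.of_le (by exact_mod_cast le_top))

theorem BucAt.of_succ (hα₀ : 0 < α) (hα₁ : α < 1) (h : BucAt (k + 1) α f x) : BucAt k α f x :=
  .of_contDiffAt hα₀ hα₁ h.1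

theorem BucAt.differentiableAt (h : BucAt (k + 1) α f x) : DifferentiableAt ℝ f x :=
  h.1.differentiableAt (by simp)

theorem BucAt.clm_comp (hα₀ : 0 < α) (L : F →L[ℝ] G) (h : BucAt k α f x) :
    BucAt k α (fun y => L (f y)) x := by
  induction k generalizing F G with
  | zero =>
    rw [bucAt_zero_iff hα₀] at h ⊢
    exact h.mono fun y hy => hy.clm_comp L
  | succ k ih =>
    rw [bucAt_succ_iff] at h ⊢
    refine ⟨h.1.mono fun y hy => L.differentiableAt.comp y hy, ?_⟩
    refine (ih (ContinuousLinearMap.compL ℝ E F G L) h.2).congr ?_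
    filter_upwards [h.1] with y hy
    exact (L.hasFDerivAt.comp y hy.hasFDerivAt).fderiv.symm

theorem BucAt.prodMk (hα₀ : 0 < α) {g : E → G} (hf : BucAt k α f x) (hg : BucAt k α g x) :
    BucAt k α (fun y => (f y, g y)) x := by
  induction k generalizing F G with
  | zero =>
    rw [bucAt_zero_iff hα₀] at hf hg ⊢
    filter_upwards [hf, hg] with y h1 h2 using h1.prodMk h2
  | succ k ih =>
    rw [bucAt_succ_iff] at hf hg ⊢
    refine ⟨?_, ?_⟩
    · filter_upwards [hf.1, hg.1] with y h1 h2 using h1.prodMk h2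
    refine ((ih hf.2 hg.2).clm_comp hα₀
      (ContinuousLinearMap.prodₗᵢ ℝ (E := E) (F := F) (G := G) (𝕜 := ℝ)
        |>.toContinuousLinearEquiv : _ →L[ℝ] _)).congr ?_
    filter_upwards [hf.1, hg.1] with y h1 h2
    exact (h1.hasFDerivAt.prodMk h2.hasFDerivAt).fderiv.symm

theorem BucAt.add (hα₀ : 0 < α) {g : E → F} (hf : BucAt k α f x) (hg : BucAt k α g x) :
    BucAt k α (fun y => f y + g y) x :=
  (hf.prodMk hα₀ hg).clm_comp hα₀ (ContinuousLinearMap.fst ℝ F F + ContinuousLinearMap.snd ℝ F F)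

theorem BucAt.bilinear (hα₀ : 0 < α) (hα₁ : α < 1) {g : E → G} (B : F →L[ℝ] G →L[ℝ] H)
    (hf : BucAt k α f x) (hg : BucAt k α g x) : BucAt k α (fun y => B (f y) (g y)) x := by
  induction k generalizing F G H with
  | zero =>
    rw [bucAt_zero_iff hα₀] at hf hg ⊢
    filter_upwards [hf, hg] with y h1 h2 using h1.bilinear hα₀ B h2
  | succ k ih =>
    have hf' := bucAt_succ_iff.1 hf
    have hg' := bucAt_succ_iff.1 hg
    refine bucAt_succ_iff.2 ⟨?_, ?_⟩
    · filter_upwards [hf'.1, hg'.1] with y h1 h2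
      exact (B.hasFDerivAt_of_bilinear h1.hasFDerivAt h2.hasFDerivAt).differentiableAt
    refine ((ih (B.precompR E) (hf.of_succ hα₀ hα₁) hg'.2).add hα₀
      (ih (B.precompL E) hf'.2 (hg.of_succ hα₀ hα₁))).congr ?_
    filter_upwards [hf'.1, hg'.1] with y h1 h2
    exact (B.hasFDerivAt_of_bilinear h1.hasFDerivAt h2.hasFDerivAt).fderiv.symm

/-- For `k = 0` an inner map that is only Hölder would spoil the exponent; the separate `C^1`
hypothesis makes it Lipschitz and survives the induction unchanged. -/
theorem BucAt.comp' (hα₀ : 0 < α) (hα₁ : α < 1) {g : F → G} (hg : BucAt k α g (f x))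
    (hf : BucAt k α f x) (hf1 : ContDiffAt ℝ 1 f x) : BucAt k α (fun y => g (f y)) x := by
  have hfe := hf1.eventually (by simp)
  induction k generalizing G with
  | zero =>
    rw [bucAt_zero_iff hα₀] at hg ⊢
    filter_upwards [hfe, hf1.continuousAt.eventually hg] with y h1 h2 using h2.comp hα₀ h1
  | succ k ih =>
    have hf' := bucAt_succ_iff.1 hf
    have hg' := bucAt_succ_iff.1 hg
    refine bucAt_succ_iff.2 ⟨?_, ?_⟩
    · filter_upwards [hf'.1, hf1.continuousAt.eventually hg'.1] with y h1 h2 using h2.comp y h1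
    refine ((ih hg'.2 (hf.of_succ hα₀ hα₁)).bilinear hα₀ hα₁
      (ContinuousLinearMap.compL ℝ E F G) hf'.2).congr ?_
    filter_upwards [hf'.1, hf1.continuousAt.eventually hg'.1] with y h1 h2
    exact (h2.hasFDerivAt.comp y h1.hasFDerivAt).fderiv.symm

theorem BucAt.comp (hα₀ : 0 < α) (hα₁ : α < 1) {g : F → G} (hg : BucAt (k + 1) α g (f x))
    (hf : BucAt (k + 1) α f x) : BucAt (k + 1) α (fun y => g (f y)) x :=
  hg.comp' hα₀ hα₁ hf (hf.1.of_le (by simp))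

theorem LittleHolderAt.contDiffAt_comp {g : F → G} (hα₀ : 0 < α) (hg : ContDiffAt ℝ 1 g (f x))
    (hf : LittleHolderAt α f x) : LittleHolderAt α (fun y => g (f y)) x := by
  have h1 : Tendsto (fun p : E × E => (f p.1, f p.2)) (𝓝 (x, x)) (𝓝 (f x, f x)) := by
    rw [nhds_prod_eq, nhds_prod_eq]
    exact (hf.continuousAt hα₀).tendsto.prodMap (hf.continuousAt hα₀).tendsto
  exact ((hg.hasStrictFDerivAt one_ne_zero).isBigO_sub.comp_tendsto h1).trans_isLittleO hf

/-- Here the outer map has the extra derivative, so the inner one may be merely little Hölder when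
`k = 0`. It serves for operator inversion and for normalizing gradients. -/
theorem BucAt.contDiffAt_comp (hα₀ : 0 < α) (hα₁ : α < 1) {g : F → G}
    (hg : ContDiffAt ℝ (k + 1 : ℕ) g (f x)) (hf : BucAt k α f x) :
    BucAt k α (fun y => g (f y)) x := by
  have hfc := hf.1.continuousAt
  have hge := hfc.eventually (hg.eventually (by simp))
  induction k generalizing G with
  | zero =>
    rw [bucAt_zero_iff hα₀] at hf ⊢
    filter_upwards [hge, hf] with y h1 h2 using h2.contDiffAt_comp hα₀ (by simpa using h1)
  | succ k ih =>
    have hf' := bucAt_succ_iff.1 hf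
    refine bucAt_succ_iff.2 ⟨?_, ?_⟩
    · filter_upwards [hf'.1, hge] with y h1 h2 using (h2.differentiableAt (by simp)).comp y h1
    have hg' : ContDiffAt ℝ (k + 1 : ℕ) (fderiv ℝ g) (f x) := hg.fderiv_right (by norm_cast)
    refine ((ih hg' (hf.of_succ hα₀ hα₁) (hfc.eventually (hg'.eventually (by simp)))).bilinear
      hα₀ hα₁ (ContinuousLinearMap.compL ℝ E F G) hf'.2).congr ?_
    filter_upwards [hf'.1, hge] with y h1 h2
    exact ((h2.differentiableAt (by simp)).hasFDerivAt.comp y h1.hasFDerivAt).fderiv.symm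

/-- The inverse function theorem in the class `buc^{k+1+α}`. -/
theorem BucAt.exists_openPartialHomeomorph (hα₀ : 0 < α) (hα₁ : α < 1) [CompleteSpace E]
    (h : BucAt (k + 1) α f x) (f' : E ≃L[ℝ] F) (hf' : HasFDerivAt f (f' : E →L[ℝ] F) x) :
    ∃ e : OpenPartialHomeomorph E F, x ∈ e.source ∧ (e : E → F) = f ∧
      ∀ y ∈ e.target, BucAt (k + 1) α e.symm y := by
  set e₀ := h.1.toOpenPartialHomeomorph f hf' (by simp)
  have hcont : ContinuousAt (fderiv ℝ f) x :=
    (h.1.fderiv_right (m := 0) (by simp)).continuousAt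
  have hinv : ∀ᶠ y in 𝓝 x, fderiv ℝ f y ∈ range ((↑) : (E ≃L[ℝ] F) → E →L[ℝ] F) :=
    hcont.eventually (by rw [hf'.fderiv]; exact f'.nhds)
  obtain ⟨s, hs, hso, hxs⟩ := _root_.eventually_nhds_iff.1 (hinv.and h.eventually)
  refine ⟨e₀.restrOpen s hso, ?_, rfl, ?_⟩
  · simpa using ⟨h.1.mem_toOpenPartialHomeomorph_source hf' (by simp), hxs⟩
  set e := e₀.restrOpen s hso
  have hes : ∀ y ∈ e.target, e.symm y ∈ s := fun y hy => by
    have := e.map_target hy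
    simp only [e, OpenPartialHomeomorph.restrOpen_source] at this
    exact this.2
  have hsymm : ∀ y ∈ e.target, ContDiffAt ℝ (k + 1 : ℕ) e.symm y ∧
      fderiv ℝ e.symm y = ContinuousLinearMap.inverse (fderiv ℝ f (e.symm y)) := by
    intro y hy
    obtain ⟨⟨g', hg'⟩, hb⟩ := hs _ (hes y hy)
    have hd : HasFDerivAt f (g' : E →L[ℝ] F) (e.symm y) := by
      rw [hg']; exact hb.differentiableAt.hasFDerivAt
    refine ⟨e.contDiffAt_symm hy hd hb.1, ?_⟩
    rw [(e.hasFDerivAt_symm hy hd).fderiv, ← hg', ContinuousLinearMap.inverse_equiv]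
  -- Bootstrapping with `D(f⁻¹) = (Df ∘ f⁻¹)⁻¹`: if the inverse has class `j`, so does the
  -- right-hand side, hence the inverse has class `j + 1`.
  have key : ∀ j ≤ k + 1, ∀ y ∈ e.target, BucAt j α e.symm y := by
    intro j
    induction j with
    | zero =>
      intro _ y hy
      exact .of_contDiffAt hα₀ hα₁ ((hsymm y hy).1.of_le (by simp))
    | succ j ih =>
      intro hj y hy
      have hev : ∀ᶠ z in 𝓝 y, z ∈ e.target := e.open_target.mem_nhds hy
      refine bucAt_succ_iff.2 ⟨hev.mono fun z hz => (hsymm z hz).1.differentiableAt (by simp), ?_⟩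
      obtain ⟨⟨g', hg'⟩, hb⟩ := hs _ (hes y hy)
      have hle : ∀ {i : ℕ}, i ≤ k → BucAt i α (fderiv ℝ f) (e.symm y) := by
        intro i hi
        rcases eq_or_lt_of_le hi with rfl | hi
        · exact (bucAt_succ_iff.1 hb).2
        · exact .of_contDiffAt hα₀ hα₁ ((bucAt_succ_iff.1 hb).2.1.of_le (by exact_mod_cast hi))
      have h1 : ContDiffAt ℝ 1 e.symm y := (hsymm y hy).1.of_le (by simp)
      have h2 : BucAt j α (fun z => fderiv ℝ f (e.symm z)) y :=
        (hle (by omega)).comp' hα₀ hα₁ (ih (by omega) y hy) h1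
      have h3 : ContDiffAt ℝ (j + 1 : ℕ) (ContinuousLinearMap.inverse (M := E) (M₂ := F) (R := ℝ))
          (fderiv ℝ f (e.symm y)) := by
        rw [← hg']; exact contDiffAt_map_inverse g'
      exact (BucAt.contDiffAt_comp (f := fun z => fderiv ℝ f (e.symm z)) hα₀ hα₁ h3 h2).congr
        (hev.mono fun z hz => (hsymm z hz).2.symm)
  exact key (k + 1) le_rfl

end LittleHolderGerms

/-! ### Equivalence of the germ condition with the local little Hölder spaces. -/

section LittleHolderSpaces

set_option linter.unusedSectionVars false

open Filter Asymptotics Topology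

variable {E F : Type} [NormedAddCommGroup E] [NormedSpace ℝ E]
  [NormedAddCommGroup F] [NormedSpace ℝ F]

variable {α : ℝ} {k : ℕ} {f : E → F} {x : E}

theorem HolderNormLE.mono {O O' : Set E} {C : ℝ} (h : HolderNormLE k α f O C) (hO : O' ⊆ O) :
    HolderNormLE k α f O' C :=
  ⟨h.1.mono hO, fun i hi x hx => h.2.1 i hi x (hO hx),
    fun x hx y hy => h.2.2 x (hO hx) y (hO hy)⟩

theorem IsBUC.mono {O O' : Set E} (h : IsBUC k α f O) (hO : O' ⊆ O) : IsBUC k α f O' :=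
  ⟨fun i hi => (h.1 i hi).mono hO, h.2.imp fun _ hC => hC.mono hO⟩

theorem IsLittleHolder.mono {O O' : Set E} (h : IsLittleHolder k α f O) (hO : O' ⊆ O) :
    IsLittleHolder k α f O' := by
  obtain ⟨h1, β, h2, h3, h4⟩ := h
  refine ⟨h1.mono hO, β, h2, h3, fun ε hε => ?_⟩
  obtain ⟨g, hg, hfg⟩ := h4 ε hε
  exact ⟨g, hg.mono hO, hfg.mono hO⟩

theorem isLittleO_dist_rpow {β : ℝ} (hα₀ : 0 < α) (h : α < β) (x : E) :
    (fun p : E × E => dist p.1 p.2 ^ β) =o[𝓝 (x, x)] fun p => dist p.1 p.2 ^ α := by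
  have hβ : 0 < β - α := by linarith
  have h1 : Tendsto (fun p : E × E => dist p.1 p.2 ^ (β - α)) (𝓝 (x, x)) (𝓝 0) := by
    have : Continuous fun p : E × E => dist p.1 p.2 ^ (β - α) :=
      (continuous_fst.dist continuous_snd).rpow_const fun _ => Or.inr hβ.le
    simpa [Real.zero_rpow hβ.ne'] using this.tendsto (x, x)
  rw [isLittleO_iff]
  intro c hc
  filter_upwards [h1.eventually (gt_mem_nhds hc)] with p hp
  rw [Real.norm_of_nonneg (by positivity), Real.norm_of_nonneg (by positivity)]
  rcases eq_or_lt_of_le (dist_nonneg (x := p.1) (y := p.2)) with h0 | h0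
  · rw [← h0, Real.zero_rpow (by linarith)]
    positivity
  calc dist p.1 p.2 ^ β = dist p.1 p.2 ^ (β - α) * dist p.1 p.2 ^ α := by
        rw [← Real.rpow_add h0]; simp
    _ ≤ c * dist p.1 p.2 ^ α := by gcongr

/-- Split `f` into an approximant `g` and the remainder. The remainder contributes at most `(ε / 2)
d^α`, while the increments of `g` are `O(d^β) = o(d^α)`. -/
theorem IsLittleHolder.bucAt (hα₀ : 0 < α) {W : Set E} (hW : IsOpen W) (h : IsLittleHolder k α f W)
    (hx : x ∈ W) : BucAt k α f x := by
  obtain ⟨⟨-, C₀, hf, -⟩, β, hβ, -, hg⟩ := h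
  refine ⟨hf.contDiffAt (hW.mem_nhds hx), ?_⟩
  filter_upwards [hW.mem_nhds hx] with y hy
  refine IsLittleO.of_bound fun ε hε => ?_
  obtain ⟨g, ⟨-, C, hgC⟩, hfg⟩ := hg (ε / 2) (by positivity)
  have hWW : ∀ᶠ p : E × E in 𝓝 (y, y), p.1 ∈ W ∧ p.2 ∈ W :=
    eventually_nhds_prod_self (hW.mem_nhds hy)
  have hε' : 0 < ε / 2 / (|C| + 1) := by positivity
  filter_upwards [hWW, (isLittleO_dist_rpow hα₀ hβ y).bound hε'] with p ⟨h1, h2⟩ h3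
  have e : ∀ z ∈ W, iteratedFDeriv ℝ k f z =
      iteratedFDeriv ℝ k (fun x => f x - g x) z + iteratedFDeriv ℝ k g z := fun z hz => by
    rw [show (fun x => f x - g x) = f - g from rfl, iteratedFDeriv_sub_apply
      (hf.contDiffAt (hW.mem_nhds hz)) (hgC.1.contDiffAt (hW.mem_nhds hz)), sub_add_cancel]
  rw [Real.norm_of_nonneg (by positivity), Real.norm_of_nonneg (by positivity)] at h3
  rw [e _ h1, e _ h2, Real.norm_of_nonneg (by positivity), add_sub_add_comm]
  refine (norm_add_le _ _).trans ?_
  have h4 := hfg.2.2 _ h1 _ h2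
  have h5 := hgC.2.2 _ h1 _ h2
  have h6 : C * dist p.1 p.2 ^ β ≤ (|C| + 1) * (ε / 2 / (|C| + 1) * dist p.1 p.2 ^ α) := by
    gcongr
    linarith [le_abs_self C]
  have h7 : (|C| + 1) * (ε / 2 / (|C| + 1) * dist p.1 p.2 ^ α) = ε / 2 * dist p.1 p.2 ^ α := by
    field_simp
  linarith

/-- A Lebesgue number of the support turns the pointwise estimates into a uniform one; two points
outside the support have increment zero. -/
theorem LittleHolderAt.uniform_of_hasCompactSupport (h : ∀ x, LittleHolderAt α f x)
    (hf : HasCompactSupport f) {ε : ℝ} (hε : 0 < ε) :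
    ∃ δ > 0, ∀ x y, dist x y < δ → ‖f x - f y‖ ≤ ε * dist x y ^ α := by
  have h1 : ∀ x, ∃ U : Set E, IsOpen U ∧ x ∈ U ∧
      ∀ y ∈ U, ∀ z ∈ U, ‖f y - f z‖ ≤ ε * dist y z ^ α := by
    intro x
    have := (h x).bound hε
    rw [nhds_prod_eq, eventually_prod_self_iff'] at this
    obtain ⟨t, ht, hb⟩ := this
    obtain ⟨U, hUt, hU, hxU⟩ := _root_.mem_nhds_iff.1 ht
    refine ⟨U, hU, hxU, fun y hy z hz => ?_⟩
    simpa [abs_of_nonneg (Real.rpow_nonneg dist_nonneg α)] using! hb y (hUt hy) z (hUt hz)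
  choose U hU hxU hb using h1
  obtain ⟨δ, hδ, hL⟩ := lebesgue_number_lemma_of_metric hf.isCompact hU
    fun x _ => mem_iUnion.2 ⟨x, hxU x⟩
  refine ⟨δ, hδ, fun x y hxy => ?_⟩
  by_cases hx : x ∈ tsupport f
  · obtain ⟨i, hi⟩ := hL x hx
    exact hb i _ (hi (mem_ball_self hδ)) _ (hi (by rwa [mem_ball, dist_comm]))
  by_cases hy : y ∈ tsupport f
  · obtain ⟨i, hi⟩ := hL y hy
    exact hb i _ (hi hxy) _ (hi (mem_ball_self hδ))
  · rw [image_eq_zero_of_notMem_tsupport hx, image_eq_zero_of_notMem_tsupport hy]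
    simp only [sub_self, norm_zero]; positivity

/-- Close points are controlled by the uniform little Hölder estimate, points at distance at least
`δ` by the supremum bound divided by `δ ^ α`. -/
theorem isBUC_univ_of_hasCompactSupport (hα₀ : 0 < α) (h : ∀ x, BucAt k α f x) (hf : HasCompactSupport f) :
    IsBUC k α f univ := by
  have hc : ContDiff ℝ k f := contDiff_iff_contDiffAt.2 fun x => (h x).1
  have hcont : ∀ i ≤ k, Continuous (iteratedFDeriv ℝ i f) := fun i hi =>
    hc.continuous_iteratedFDeriv (by exact_mod_cast hi)
  have hsupp : ∀ i, HasCompactSupport (iteratedFDeriv ℝ i f) := fun i => hf.iteratedFDeriv i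
  have hbd : ∀ i ≤ k, ∃ M : ℝ, ∀ x, ‖iteratedFDeriv ℝ i f x‖ ≤ M := fun i hi =>
    (hsupp i).exists_bound_of_continuous (hcont i hi)
  have hbd' : ∃ M : ℝ, 0 ≤ M ∧ ∀ i ≤ k, ∀ x, ‖iteratedFDeriv ℝ i f x‖ ≤ M := by
    choose! M hM using hbd
    refine ⟨∑ i ∈ Finset.range (k + 1), |M i|, by positivity, fun i hi x => ?_⟩
    refine ((hM i hi x).trans (le_abs_self _)).trans ?_
    exact Finset.single_le_sum (f := fun i => |M i|) (fun _ _ => abs_nonneg _)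
      (Finset.mem_range.2 (by omega))
  obtain ⟨M, hM0, hM⟩ := hbd'
  obtain ⟨δ, hδ, hH⟩ := LittleHolderAt.uniform_of_hasCompactSupport
    (fun x => (h x).2.self_of_nhds) (hsupp k) one_pos
  refine ⟨fun i hi => ((hsupp i).uniformContinuous_of_continuous
    (hcont i hi)).uniformContinuousOn, max M (max 1 (2 * M / δ ^ α)), hc.contDiffOn,
    fun i hi x _ => (hM i hi x).trans (le_max_left _ _), fun x _ y _ => ?_⟩
  rcases lt_or_ge (dist x y) δ with hd | hd
  · refine (hH x y hd).trans ?_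
    gcongr
    exact (le_max_left _ _).trans (le_max_right _ _)
  · have h1 : δ ^ α ≤ dist x y ^ α := Real.rpow_le_rpow hδ.le hd hα₀.le
    have h2 : 0 < δ ^ α := Real.rpow_pos_of_pos hδ α
    calc ‖iteratedFDeriv ℝ k f x - iteratedFDeriv ℝ k f y‖ ≤ M + M :=
          (norm_sub_le _ _).trans (add_le_add (hM k le_rfl x) (hM k le_rfl y))
      _ = 2 * M / δ ^ α * δ ^ α := by field_simp; ring
      _ ≤ _ := by
        gcongr
        exact (le_max_right _ _).trans (le_max_right _ _)

section Mollification

/-- Mollification by a normalized bump function. -/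
noncomputable def mollify [MeasurableSpace E] [FiniteDimensional ℝ E] (μ : Measure E)
    (φ : ContDiffBump (0 : E)) (f : E → F) : E → F :=
  φ.normed μ ⋆[ContinuousLinearMap.lsmul ℝ ℝ, μ] f

variable [FiniteDimensional ℝ E] [MeasurableSpace E] [BorelSpace E] {μ : Measure E}
  [μ.IsAddHaarMeasure] [CompleteSpace F] {φ : ContDiffBump (0 : E)}

theorem integrable_normed_smul (hf : Continuous f) (x : E) :
    Integrable (fun t => φ.normed μ t • f (x - t)) μ :=
  φ.hasCompactSupport_normed.convolutionExists_left (ContinuousLinearMap.lsmul ℝ ℝ)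
    φ.continuous_normed hf.locallyIntegrable x

theorem contDiff_mollify (hf : Continuous f) : ContDiff ℝ ∞ (mollify μ φ f) :=
  φ.hasCompactSupport_normed.contDiff_convolution_left _ φ.contDiff_normed hf.locallyIntegrable

theorem fderiv_mollify (hf : ContDiff ℝ 1 f) (hs : HasCompactSupport f) :
    fderiv ℝ (mollify μ φ f) = mollify μ φ (fderiv ℝ f) := by
  ext1 x
  rw [mollify, (hs.hasFDerivAt_convolution_right (ContinuousLinearMap.lsmul ℝ ℝ)
    φ.continuous_normed.locallyIntegrable hf x).fderiv]
  rfl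

theorem mollify_linearIsometryEquiv_comp {G : Type} [NormedAddCommGroup G] [NormedSpace ℝ G]
    (e : F ≃ₗᵢ[ℝ] G) : mollify μ φ (fun x => e (f x)) = fun x => e (mollify μ φ f x) := by
  ext1 x
  simp only [mollify, convolution_def, ContinuousLinearMap.lsmul_apply]
  rw [← LinearIsometryEquiv.coe_toContinuousLinearEquiv, ← ContinuousLinearEquiv.integral_comp_comm]
  simp

theorem iteratedFDeriv_mollify (hf : ContDiff ℝ k f) (hs : HasCompactSupport f) :
    iteratedFDeriv ℝ k (mollify μ φ f) = mollify μ φ (iteratedFDeriv ℝ k f) := by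
  induction k generalizing F with
  | zero =>
    exact (mollify_linearIsometryEquiv_comp (f := f)
      (continuousMultilinearCurryFin0 ℝ E F).symm).symm
  | succ k ih =>
    have h1 : ∀ g : E → F, iteratedFDeriv ℝ (k + 1) g = fun x =>
        (continuousMultilinearCurryRightEquiv' ℝ k E F).symm
          (iteratedFDeriv ℝ k (fderiv ℝ g) x) := fun g => by
      ext1 x; exact iteratedFDeriv_succ_eq_comp_right
    rw [h1, h1, fderiv_mollify (hf.of_le (by simp)) hs,
      ih (hf.fderiv_right (by norm_cast)) (hs.fderiv ℝ)]
    exact (mollify_linearIsometryEquiv_comp (f := iteratedFDeriv ℝ k (fderiv ℝ f))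
      (continuousMultilinearCurryRightEquiv' ℝ k E F).symm).symm

/-- A mollification is an average of translates, so it inherits every translation-invariant bound on
increments. -/
theorem norm_mollify_sub_mollify_le (hf : Continuous f) {x y : E} {C : ℝ}
    (h : ∀ t, ‖f (x - t) - f (y - t)‖ ≤ C) : ‖mollify μ φ f x - mollify μ φ f y‖ ≤ C := by
  simp only [mollify, convolution_def, ContinuousLinearMap.lsmul_apply]
  rw [← integral_sub (integrable_normed_smul hf x) (integrable_normed_smul hf y)]
  have h1 : ∫ t, φ.normed μ t * C ∂μ = C := by
    rw [integral_mul_const, φ.integral_normed, one_mul]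
  refine (norm_integral_le_of_norm_le (φ.integrable_normed.mul_const C)
    (Eventually.of_forall fun t => ?_)).trans_eq h1
  rw [← smul_sub, norm_smul, Real.norm_of_nonneg (φ.nonneg_normed t)]
  exact mul_le_mul_of_nonneg_left (h t) (φ.nonneg_normed t)

end Mollification

variable [FiniteDimensional ℝ E] [CompleteSpace F]

/-- Below a scale `δ` both `f` and its mollification have small Hölder quotients, whatever the
mollification radius. With `δ` fixed, a small radius makes the difference so small in `C^k` that
larger scales are harmless too. -/
theorem exists_contDiff_holderNormLE_sub (hα₀ : 0 < α) (h : ∀ x, BucAt k α f x)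
    (hf : HasCompactSupport f) {ε : ℝ} (hε : 0 < ε) :
    ∃ g : E → F, ContDiff ℝ ∞ g ∧ HasCompactSupport g ∧
      HolderNormLE k α (fun x => f x - g x) univ ε := by
  borelize E
  have hc : ContDiff ℝ k f := contDiff_iff_contDiffAt.2 fun x => (h x).1
  have hci : ∀ i ≤ k, ContDiff ℝ i f := fun i hi => hc.of_le (by exact_mod_cast hi)
  have hcont : ∀ i ≤ k, Continuous (iteratedFDeriv ℝ i f) := fun i hi =>
    hc.continuous_iteratedFDeriv (by exact_mod_cast hi)
  have hsupp : ∀ i, HasCompactSupport (iteratedFDeriv ℝ i f) := fun i => hf.iteratedFDeriv i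
  obtain ⟨δ, hδ, hH⟩ := LittleHolderAt.uniform_of_hasCompactSupport
    (fun x => (h x).2.self_of_nhds) (hsupp k) (half_pos hε)
  have hδα : 0 < δ ^ α := Real.rpow_pos_of_pos hδ α
  -- The second entry ensures `2 η ≤ ε d^α` for every distance `d ≥ δ`.
  set η := min ε (ε * δ ^ α / 2)
  have hη : 0 < η := by positivity
  have hρ : ∀ i ∈ Iic k, ∀ᶠ ρ : ℝ in 𝓝[>] 0, ∀ x y, dist x y < ρ →
      dist (iteratedFDeriv ℝ i f x) (iteratedFDeriv ℝ i f y) ≤ η := by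
    intro i hi
    obtain ⟨ρ, hρ, hρ'⟩ := Metric.uniformContinuous_iff.1
      ((hsupp i).uniformContinuous_of_continuous (hcont i hi)) η hη
    filter_upwards [Ioo_mem_nhdsGT hρ] with r hr x y hxy
    exact (hρ' (hxy.trans hr.2)).le
  obtain ⟨ρ, hρ, hρ0⟩ :=
    (((eventually_all_finite (finite_Iic k)).2 hρ).and self_mem_nhdsWithin).exists
  let φ : ContDiffBump (0 : E) := ⟨ρ / 2, ρ, half_pos hρ0, half_lt_self hρ0⟩
  let μ : Measure E := Measure.addHaar
  have hg : ContDiff ℝ ∞ (mollify μ φ f) := contDiff_mollify hc.continuous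
  have hgk : ∀ i : ℕ, ContDiff ℝ i (mollify μ φ f) := fun i =>
    hg.of_le (by exact_mod_cast le_top)
  refine ⟨mollify μ φ f, hg, φ.hasCompactSupport_normed.convolution _ hf,
    (hc.sub (hgk k)).contDiffOn, ?_⟩
  have hD : ∀ i ≤ k, ∀ x, iteratedFDeriv ℝ i (fun x => f x - mollify μ φ f x) x =
      iteratedFDeriv ℝ i f x - mollify μ φ (iteratedFDeriv ℝ i f) x := fun i hi x => by
    rw [← iteratedFDeriv_mollify (hci i hi) hf]
    exact iteratedFDeriv_sub_apply (hci i hi).contDiffAt (hgk i).contDiffAt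
  have hle : ∀ i ≤ k, ∀ x,
      ‖iteratedFDeriv ℝ i (fun x => f x - mollify μ φ f x) x‖ ≤ η := fun i hi x => by
    rw [hD i hi, ← dist_eq_norm, dist_comm]
    exact φ.dist_normed_convolution_le (hcont i hi).aestronglyMeasurable
      fun y hy => hρ i hi y x hy
  refine ⟨fun i hi x _ => (hle i hi x).trans (min_le_left _ _), fun x _ y _ => ?_⟩
  rcases lt_or_ge (dist x y) δ with hd | hd
  · rw [hD k le_rfl, hD k le_rfl, sub_sub_sub_comm]
    refine (norm_sub_le _ _).trans ?_
    have h1 := norm_mollify_sub_mollify_le (μ := μ) (φ := φ) (x := x) (y := y)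
      (C := ε / 2 * dist x y ^ α) (hcont k le_rfl) fun t => by
        have := hH (x - t) (y - t) (by simpa using hd)
        simpa using this
    linarith [hH x y hd]
  · have h1 : δ ^ α ≤ dist x y ^ α := Real.rpow_le_rpow hδ.le hd hα₀.le
    calc _ ≤ η + η := (norm_sub_le _ _).trans (add_le_add (hle k le_rfl x) (hle k le_rfl y))
      _ ≤ ε * δ ^ α / 2 + ε * δ ^ α / 2 := add_le_add (min_le_right _ _) (min_le_right _ _)
      _ = ε * δ ^ α := by ring
      _ ≤ _ := by gcongr

theorem BucAt.isLittleHolder_univ (hα₀ : 0 < α) (hα₁ : α < 1) (h : ∀ x, BucAt k α f x)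
    (hf : HasCompactSupport f) : IsLittleHolder k α f univ := by
  refine ⟨isBUC_univ_of_hasCompactSupport hα₀ h hf, (α + 1) / 2, by linarith, by linarith,
    fun ε hε => ?_⟩
  obtain ⟨g, hg, hgs, hfg⟩ := exists_contDiff_holderNormLE_sub hα₀ h hf hε
  exact ⟨g, isBUC_univ_of_hasCompactSupport (by linarith) (fun x => .of_contDiffAt_infty
    (by linarith) (by linarith) hg.contDiffAt) hgs, hfg⟩

/-- Multiplying by a bump function supported where the germ condition holds reduces to the compactly
supported case. -/
theorem BucAt.exists_isLittleHolder (hα₀ : 0 < α) (hα₁ : α < 1) (h : BucAt k α f x) :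
    ∃ g, IsLittleHolder k α g univ ∧ g =ᶠ[𝓝 x] f := by
  obtain ⟨r, hr, hU⟩ := Metric.eventually_nhds_iff.1 h.eventually
  let χ : ContDiffBump x := ⟨r / 3, r / 2, by positivity, by linarith⟩
  refine ⟨fun y => χ y • f y, BucAt.isLittleHolder_univ hα₀ hα₁ (fun y => ?_)
    χ.hasCompactSupport.smul_right, ?_⟩
  · by_cases hy : dist y x < r
    · exact (BucAt.of_contDiffAt_infty (f := χ) hα₀ hα₁ χ.contDiffAt).bilinear hα₀ hα₁
        (ContinuousLinearMap.lsmul ℝ ℝ) (hU hy)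
    · have h0 : BucAt k α (fun _ : E => (0 : F)) y := .of_contDiffAt_infty hα₀ hα₁ contDiffAt_const
      refine h0.congr ?_
      have : y ∉ tsupport χ := by
        rw [χ.tsupport_eq, mem_closedBall]
        change ¬ dist y x ≤ r / 2
        linarith
      filter_upwards [(isClosed_tsupport χ).isOpen_compl.mem_nhds this] with z hz
      rw [image_eq_zero_of_notMem_tsupport hz, zero_smul]
  · filter_upwards [χ.eventuallyEq_one] with y hy
    rw [hy, Pi.one_apply, one_smul]

end LittleHolderSpaces

/-! ### Smoothness of the superposition operator on continuous functions. -/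

section SuperpositionOperator

open Filter Asymptotics Topology

variable {K : Type} [TopologicalSpace K] [CompactSpace K] {E F : Type} [NormedAddCommGroup E]
  [NormedSpace ℝ E] [NormedAddCommGroup F] [NormedSpace ℝ F]

/-- Pointwise application of a continuous family of operators to a continuous function. -/
noncomputable def ContinuousMap.applyCLM : C(K, E →L[ℝ] F) →L[ℝ] C(K, E) →L[ℝ] C(K, F) :=
  LinearMap.mkContinuous₂
    (LinearMap.mk₂ ℝ (fun (A : C(K, E →L[ℝ] F)) (h : C(K, E)) =>
        (⟨fun t => A t (h t), by fun_prop⟩ : C(K, F)))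
      (fun _ _ _ => by ext; simp) (fun _ _ _ => by ext; simp)
      (fun _ _ _ => by ext; simp) (fun _ _ _ => by ext; simp)) 1 fun A h => by
    refine (ContinuousMap.norm_le _ (by positivity)).2 fun t => ?_
    rw [one_mul]
    exact (A t).le_of_opNorm_le_of_le (A.norm_coe_le_norm t) (h.norm_coe_le_norm t)

@[simp]
theorem ContinuousMap.applyCLM_apply (A : C(K, E →L[ℝ] F)) (h : C(K, E)) (t : K) :
    ContinuousMap.applyCLM A h t = A t (h t) := rfl

theorem ContinuousMap.norm_applyCLM_le (A : C(K, E →L[ℝ] F)) :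
    ‖ContinuousMap.applyCLM A‖ ≤ ‖A‖ := by
  refine ContinuousLinearMap.opNorm_le_bound _ (norm_nonneg A) fun h => ?_
  refine (ContinuousMap.norm_le _ (by positivity)).2 fun t => ?_
  exact (A t).le_of_opNorm_le_of_le (A.norm_coe_le_norm t) (h.norm_coe_le_norm t)

/-- The mean value inequality at each `t`, with uniform continuity of `v'`, makes the first-order
remainder small in the supremum norm. -/
theorem hasFDerivAt_superposition (v : C(E, F)) (v' : C(E, E →L[ℝ] F))
    (hv : ∀ x, HasFDerivAt v (v' x) x) (hv' : UniformContinuous v') (u : C(K, E)) :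
    HasFDerivAt (fun u : C(K, E) => v.comp u) (ContinuousMap.applyCLM (v'.comp u)) u := by
  rw [hasFDerivAt_iff_isLittleO_nhds_zero]
  refine IsLittleO.of_bound fun ε hε => ?_
  obtain ⟨δ, hδ, hd⟩ := Metric.uniformContinuous_iff.1 hv' ε hε
  filter_upwards [ball_mem_nhds (0 : C(K, E)) hδ] with h hh
  refine (ContinuousMap.norm_le _ (by positivity)).2 fun t => ?_
  rw [mem_ball_zero_iff] at hh
  have ht : ‖h t‖ < δ := (h.norm_coe_le_norm t).trans_lt hh
  have := (convex_ball (u t) δ).norm_image_sub_le_of_norm_hasFDerivWithin_le' (f := v)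
    (f' := fun x => v' x) (φ := v' (u t)) (C := ε) (y := u t + h t)
    (fun x _ => (hv x).hasFDerivWithinAt)
    (fun x hx => by rw [← dist_eq_norm]; exact (hd hx).le) (mem_ball_self hδ) (by simpa using ht)
  simp only [add_sub_cancel_left] at this
  refine le_trans ?_ (mul_le_mul_of_nonneg_left (h.norm_coe_le_norm t) hε.le)
  simpa using this

/-- The derivative is the superposition operator of `fderiv ℝ v` followed by a bounded linear map,
so induction applies; compact support supplies the uniform continuity. -/
theorem contDiff_superposition (v : C(E, F)) (hv : ContDiff ℝ ∞ v) (hs : HasCompactSupport v)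
    (n : ℕ) : ContDiff ℝ n (fun u : C(K, E) => v.comp u) := by
  induction n generalizing F with
  | zero => exact_mod_cast contDiff_zero.2 (ContinuousMap.continuous_postcomp v)
  | succ n ih =>
    have hv1 : ContDiff ℝ ∞ (fderiv ℝ v) := hv.fderiv_right (by simp)
    push_cast
    rw [contDiff_succ_iff_hasFDerivAt]
    have hA : ContDiff ℝ n (fun A : C(K, E →L[ℝ] F) => ContinuousMap.applyCLM A) :=
      IsBoundedLinearMap.contDiff ⟨⟨map_add _, map_smul _⟩, 1, one_pos, fun A => by
        rw [one_mul]; exact ContinuousMap.norm_applyCLM_le A⟩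
    refine ⟨fun u => ContinuousMap.applyCLM ((⟨fderiv ℝ v, hv1.continuous⟩ :
      C(E, E →L[ℝ] F)).comp u),
      hA.comp (ih ⟨fderiv ℝ v, hv1.continuous⟩ hv1 (hs.fderiv ℝ)), ?_⟩
    exact hasFDerivAt_superposition v ⟨fderiv ℝ v, hv1.continuous⟩
      (fun x => (hv.differentiable (by simp) x).hasFDerivAt)
      ((hs.fderiv ℝ).uniformContinuous_of_continuous hv1.continuous)

end SuperpositionOperator

/-! ### Existence and smoothness of global flows. -/

section Flow

open Filter Topology unitInterval
open scoped NNReal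

variable {E : Type} [NormedAddCommGroup E] [NormedSpace ℝ E]

/-- `φ` is a global flow of the vector field `v`. -/
def IsGlobalFlow (v : E → E) (φ : E → ℝ → E) : Prop :=
  ∀ y, φ y 0 = y ∧ ∀ r, HasDerivAt (φ y) (v (φ y r)) r

theorem eqOn_Ioo_of_hasDerivAt {v : E → E} {K : ℝ≥0} (hv : LipschitzWith K v) {f g : ℝ → E}
    {T : ℝ} (hT : 0 < T) (hf : ∀ t ∈ Ioo (-T) T, HasDerivAt f (v (f t)) t)
    (hg : ∀ t ∈ Ioo (-T) T, HasDerivAt g (v (g t)) t) (h : f 0 = g 0) :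
    EqOn f g (Ioo (-T) T) :=
  ODE_solution_unique_of_mem_Ioo (v := fun _ => v) (s := fun _ => univ) (K := K)
    (fun _ _ => hv.lipschitzOnWith) (t₀ := 0) (by simpa using hT)
    (fun t ht => ⟨hf t ht, trivial⟩) (fun t ht => ⟨hg t ht, trivial⟩) h

theorem eq_of_hasDerivAt {v : E → E} {K : ℝ≥0} (hv : LipschitzWith K v) {f g : ℝ → E}
    (hf : ∀ t, HasDerivAt f (v (f t)) t) (hg : ∀ t, HasDerivAt g (v (g t)) t) (h : f 0 = g 0) :
    f = g :=
  ODE_solution_unique_univ (v := fun _ => v) (s := fun _ => univ) (K := K) (t₀ := 0)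
    (fun _ => hv.lipschitzOnWith) (fun t => ⟨hf t, trivial⟩) (fun t => ⟨hg t, trivial⟩) h

/-- Picard–Lindelöf applies on any time interval, because a curve of speed at most `M` stays in the
ball of radius `M T`, where the estimates still hold. -/
theorem exists_hasDerivAt_Ioo [CompleteSpace E] {v : E → E} {K M : ℝ≥0} (hv : LipschitzWith K v)
    (hM : ∀ x, ‖v x‖ ≤ M) (y : E) {T : ℝ} (hT : 0 < T) :
    ∃ f : ℝ → E, f 0 = y ∧ ∀ t ∈ Ioo (-T) T, HasDerivAt f (v (f t)) t := by
  have h : IsPicardLindelof (fun _ => v) (tmin := -T) (tmax := T) ⟨0, by simp [hT.le]⟩ y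
      (M * ⟨T, hT.le⟩) 0 M K :=
    .of_time_independent (fun x _ => hM x) hv.lipschitzOnWith (by simp; exact le_rfl)
  obtain ⟨f, hf0, hf⟩ := h.exists_eq_forall_mem_Icc_hasDerivWithinAt₀
  exact ⟨f, hf0, fun t ht => (hf t (Ioo_subset_Icc_self ht)).hasDerivAt (Icc_mem_nhds ht.1 ht.2)⟩

theorem exists_isGlobalFlow [CompleteSpace E] {v : E → E} {K M : ℝ≥0} (hv : LipschitzWith K v)
    (hM : ∀ x, ‖v x‖ ≤ M) : ∃ φ, IsGlobalFlow v φ := by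
  have h : ∀ (y : E) (n : ℕ), ∃ f : ℝ → E, f 0 = y ∧
      ∀ t ∈ Ioo (-(n + 1 : ℝ)) (n + 1), HasDerivAt f (v (f t)) t := fun y n =>
    exists_hasDerivAt_Ioo hv hM y (by positivity)
  choose f hf0 hf using h
  have hEq : ∀ (y : E) (n m : ℕ), n ≤ m → EqOn (f y n) (f y m) (Ioo (-(n + 1 : ℝ)) (n + 1)) := by
    intro y n m hnm
    have hc : (n : ℝ) ≤ m := by exact_mod_cast hnm
    refine eqOn_Ioo_of_hasDerivAt hv (by positivity) (hf y n) (fun t ht => hf y m t ?_)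
      (by rw [hf0, hf0])
    exact ⟨by linarith [ht.1], by linarith [ht.2]⟩
  refine ⟨fun y t => f y ⌈|t|⌉₊ t, fun y => ⟨by simpa using hf0 y _, fun r => ?_⟩⟩
  -- The index `⌈|t|⌉₊` jumps with `t`; near `r` it never exceeds `N`, and by uniqueness all the
  -- pieces involved agree with the `N`-th one.
  set N := ⌈|r|⌉₊ + 1
  have hr : r ∈ Ioo (-(N : ℝ)) N := by
    have := Nat.le_ceil |r|
    simp only [N]; push_cast
    exact abs_lt.1 (by linarith)
  have hev : (fun t => f y ⌈|t|⌉₊ t) =ᶠ[𝓝 r] f y N := by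
    filter_upwards [Ioo_mem_nhds hr.1 hr.2] with t ht
    refine hEq y _ _ (Nat.ceil_le.2 (abs_lt.2 ht).le) ?_
    have := Nat.le_ceil |t|
    exact abs_lt.1 (by linarith)
  have := hf y N r ⟨by linarith [hr.1], by linarith [hr.2]⟩
  rw [← hev.eq_of_nhds] at this
  exact this.congr_of_eventuallyEq hev

variable {v : E → E} {φ : E → ℝ → E}

theorem IsGlobalFlow.add (h : IsGlobalFlow v φ) {K : ℝ≥0} (hv : LipschitzWith K v) (y : E)
    (s t : ℝ) : φ y (s + t) = φ (φ y s) t := by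
  have := eq_of_hasDerivAt hv (f := fun t => φ y (s + t)) (g := φ (φ y s))
    (fun t => HasDerivAt.comp_const_add s t ((h y).2 _)) (h _).2 (by simp [(h _).1])
  exact congrFun this t

theorem IsGlobalFlow.neg_right (h : IsGlobalFlow v φ) {K : ℝ≥0} (hv : LipschitzWith K v) (y : E)
    (t : ℝ) : φ (φ y t) (-t) = y := by
  rw [← h.add hv, add_neg_cancel, (h y).1]

theorem IsGlobalFlow.neg_left (h : IsGlobalFlow v φ) {K : ℝ≥0} (hv : LipschitzWith K v) (y : E)
    (t : ℝ) : φ (φ y (-t)) t = y := by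
  rw [← h.add hv, neg_add_cancel, (h y).1]

/-- The primitive, vanishing at `0`, of a continuous function on the unit interval. -/
noncomputable def primitiveCLM (E : Type) [NormedAddCommGroup E] [NormedSpace ℝ E] :
    C(I, E) →L[ℝ] C(I, E) :=
  LinearMap.mkContinuous
    { toFun := fun u => ⟨fun s => ∫ r in (0 : ℝ)..s, u (projIcc 0 1 zero_le_one r),
        (intervalIntegral.continuous_primitive (fun _ _ => Continuous.intervalIntegrable
          (by fun_prop) _ _) 0).comp continuous_subtype_val⟩
      map_add' := fun u w => by
        ext s
        exact intervalIntegral.integral_add (Continuous.intervalIntegrable (by fun_prop) _ _)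
          (Continuous.intervalIntegrable (by fun_prop) _ _)
      map_smul' := fun c u => by
        ext s
        exact intervalIntegral.integral_smul c _ } 1 fun u => by
    refine (ContinuousMap.norm_le _ (by positivity)).2 fun s => ?_
    refine (intervalIntegral.norm_integral_le_of_norm_le_const (C := ‖u‖)
      fun r _ => u.norm_coe_le_norm _).trans ?_
    rw [sub_zero, abs_of_nonneg s.2.1, mul_comm]
    exact mul_le_mul_of_nonneg_right s.2.2 (norm_nonneg _)

theorem primitiveCLM_apply (u : C(I, E)) (s : I) :
    primitiveCLM E u s = ∫ r in (0 : ℝ)..s, u (projIcc 0 1 zero_le_one r) := rfl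

theorem norm_primitiveCLM_le : ‖primitiveCLM E‖ ≤ 1 :=
  LinearMap.mkContinuous_norm_le _ zero_le_one _

/-- The map whose zeros `((x, τ), u)` are the solutions of `u' = τ v(u)`, `u(0) = x`. -/
noncomputable def integralEquationMap (v : C(E, E)) (p : (E × ℝ) × C(I, E)) : C(I, E) :=
  p.2 - ContinuousMap.const I p.1.1 - p.1.2 • primitiveCLM E (v.comp p.2)

theorem contDiff_integralEquationMap (v : C(E, E)) (hv : ContDiff ℝ ∞ v)
    (hs : HasCompactSupport v) : ContDiff ℝ ∞ (integralEquationMap v) := by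
  have h1 : ContDiff ℝ ∞ (fun u : C(I, E) => v.comp u) :=
    contDiff_infty.2 fun n => contDiff_superposition v hv hs n
  have h2 : ContDiff ℝ ∞ (fun x : E => ContinuousMap.const I x) := by
    have : IsBoundedLinearMap ℝ (fun x : E => ContinuousMap.const I x) :=
      IsLinearMap.with_bound ⟨fun _ _ => rfl, fun _ _ => rfl⟩ 1 fun x => by
        simp [ContinuousMap.norm_le _ (norm_nonneg x)]
    exact this.contDiff
  unfold integralEquationMap
  exact (contDiff_snd.sub (h2.comp (contDiff_fst.comp contDiff_fst))).sub
    ((contDiff_snd.comp contDiff_fst).smul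
      ((primitiveCLM E).contDiff.comp (h1.comp contDiff_snd)))

/-- The curve `s ↦ φ x (τ s)` on the unit interval. -/
noncomputable def IsGlobalFlow.curve (h : IsGlobalFlow v φ) (p : E × ℝ) : C(I, E) :=
  ⟨fun s => φ p.1 (p.2 * s), by
    have : Continuous (φ p.1) := continuous_iff_continuousAt.2 fun t => ((h _).2 t).continuousAt
    fun_prop⟩

theorem IsGlobalFlow.integralEquationMap_curve [CompleteSpace E] {v : C(E, E)}
    (h : IsGlobalFlow v φ) (p : E × ℝ) : integralEquationMap v (p, h.curve p) = 0 := by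
  ext s
  have hc : Continuous (φ p.1) := continuous_iff_continuousAt.2 fun t => ((h _).2 t).continuousAt
  have h1 : ∀ r : ℝ, HasDerivAt (fun r => φ p.1 (p.2 * r)) (p.2 • v (φ p.1 (p.2 * r))) r :=
    fun r => by
      have := ((h p.1).2 (p.2 * r)).scomp r ((hasDerivAt_id r).const_mul p.2)
      simpa [Function.comp_def] using this
  have h2 := intervalIntegral.integral_eq_sub_of_hasDerivAt (a := 0) (b := s)
    (fun r _ => h1 r) (Continuous.intervalIntegrable (by fun_prop) _ _)
  have h3 : ∫ r in (0 : ℝ)..s, v (φ p.1 (p.2 * (projIcc 0 1 zero_le_one r : I))) =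
      ∫ r in (0 : ℝ)..s, v (φ p.1 (p.2 * r)) := by
    refine intervalIntegral.integral_congr fun r hr => ?_
    rw [uIcc_of_le s.2.1] at hr
    simp only [projIcc_of_mem zero_le_one ⟨hr.1, hr.2.trans s.2.2⟩]
  rw [intervalIntegral.integral_smul] at h2
  simp only [integralEquationMap, ContinuousMap.sub_apply, ContinuousMap.smul_apply,
    primitiveCLM_apply, ContinuousMap.comp_apply, IsGlobalFlow.curve, ContinuousMap.coe_mk,
    ContinuousMap.const_apply, ContinuousMap.zero_apply]
  rw [h3, h2]
  simp [(h _).1]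

/-- For `|τ| K < 1` the integral operator is a contraction. Uniqueness identifies the implicit
function with the flow curve. -/
theorem integralEquationMap_unique {v : C(E, E)} {K : ℝ≥0} (hv : LipschitzWith K v) {p : E × ℝ}
    (hτ : |p.2| * K < 1) {u w : C(I, E)} (hu : integralEquationMap v (p, u) = 0)
    (hw : integralEquationMap v (p, w) = 0) : u = w := by
  have h1 : u - w = p.2 • primitiveCLM E (v.comp u - v.comp w) := by
    have := hu.trans hw.symm
    simp only [integralEquationMap] at this
    rw [map_sub, smul_sub]
    rw [sub_sub, sub_sub, sub_eq_sub_iff_add_eq_add] at this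
    rw [sub_eq_sub_iff_add_eq_add]
    have h := congrArg (· - ContinuousMap.const I p.1) this
    convert! h using 1 <;> abel
  have h2 : ‖v.comp u - v.comp w‖ ≤ K * ‖u - w‖ := by
    refine (ContinuousMap.norm_le _ (by positivity)).2 fun t => ?_
    refine (hv.norm_sub_le _ _).trans ?_
    gcongr
    exact (u - w).norm_coe_le_norm t
  have h3 : ‖u - w‖ ≤ |p.2| * K * ‖u - w‖ := by
    calc ‖u - w‖ = |p.2| * ‖primitiveCLM E (v.comp u - v.comp w)‖ := by
          conv_lhs => rw [h1]
          rw [norm_smul, Real.norm_eq_abs]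
      _ ≤ |p.2| * (1 * (K * ‖u - w‖)) := by
          gcongr
          exact (primitiveCLM E).le_of_opNorm_le_of_le norm_primitiveCLM_le h2
      _ = _ := by ring
  have h4 : ‖u - w‖ = 0 := by nlinarith [norm_nonneg (u - w)]
  exact sub_eq_zero.1 (norm_eq_zero.1 h4)

theorem isInvertible_one_sub_of_norm_le {X : Type} [NormedAddCommGroup X] [NormedSpace ℝ X]
    [CompleteSpace X] {T : X →L[ℝ] X} {c : ℝ} (hc : c < 1) (hT : ∀ x, ‖T x‖ ≤ c * ‖x‖) :
    (1 - T).IsInvertible := by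
  have h : ‖T‖ < 1 := by
    refine (T.opNorm_le_bound (le_max_right c 0) fun x => (hT x).trans ?_).trans_lt
      (max_lt hc one_pos)
    gcongr
    exact le_max_left _ _
  obtain ⟨U, hU⟩ := isUnit_one_sub_of_norm_lt_one h
  rw [← hU]
  exact ⟨ContinuousLinearEquiv.unitsEquiv ℝ _ U, rfl⟩

/-- The partial derivative in `u` is the identity minus an operator of norm at most `|τ| K < 1`, so
a Neumann series inverts it. -/
theorem isInvertible_fderiv_integralEquationMap [CompleteSpace E] (v : C(E, E))
    (hv : ContDiff ℝ ∞ v) (hs : HasCompactSupport v) {K : ℝ≥0} (hK : LipschitzWith K v)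
    {p : E × ℝ} (hτ : |p.2| * K < 1) (u : C(I, E)) :
    (fderiv ℝ (integralEquationMap v) (p, u) ∘L .inr ℝ (E × ℝ) C(I, E)).IsInvertible := by
  have hv1 : ContDiff ℝ ∞ (fderiv ℝ v) := hv.fderiv_right (by simp)
  set A : C(I, E →L[ℝ] E) := (⟨fderiv ℝ v, hv1.continuous⟩ : C(E, E →L[ℝ] E)).comp u
  have h1 : HasFDerivAt (fun u => integralEquationMap v (p, u))
      (fderiv ℝ (integralEquationMap v) (p, u) ∘L .inr ℝ (E × ℝ) C(I, E)) u :=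
    (((contDiff_integralEquationMap v hv hs).differentiable (by simp) (p, u)).hasFDerivAt).comp u
      (hasFDerivAt_prodMk_right p u)
  have h2 : HasFDerivAt (fun u : C(I, E) => v.comp u) (ContinuousMap.applyCLM A) u :=
    hasFDerivAt_superposition v ⟨fderiv ℝ v, hv1.continuous⟩
      (fun x => (hv.differentiable (by simp) x).hasFDerivAt)
      ((hs.fderiv ℝ).uniformContinuous_of_continuous hv1.continuous) u
  have h3 : HasFDerivAt (fun u => integralEquationMap v (p, u))
      (1 - p.2 • (primitiveCLM E ∘L ContinuousMap.applyCLM A)) u :=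
    ((hasFDerivAt_id u).sub_const (ContinuousMap.const I p.1)).sub
      (((primitiveCLM E).hasFDerivAt.comp u h2).const_smul p.2)
  rw [h1.unique h3]
  have hA : ‖A‖ ≤ K := (ContinuousMap.norm_le _ K.2).2 fun t => norm_fderiv_le_of_lipschitz ℝ hK
  refine isInvertible_one_sub_of_norm_le hτ fun w => ?_
  rw [smul_apply, norm_smul, Real.norm_eq_abs, mul_assoc]
  refine mul_le_mul_of_nonneg_left ?_ (abs_nonneg _)
  have h4 : ‖ContinuousMap.applyCLM A w‖ ≤ K * ‖w‖ :=
    (ContinuousMap.applyCLM A).le_of_opNorm_le ((ContinuousMap.norm_applyCLM_le A).trans hA) w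
  simpa using (primitiveCLM E).le_of_opNorm_le_of_le norm_primitiveCLM_le h4

/-- Rescaling time to the unit interval turns the final time into a parameter `τ`. The implicit
function theorem makes the curve depend smoothly on `(x, τ)`, and evaluation at `1` gives the flow.
-/
theorem IsGlobalFlow.contDiffAt_of_small [CompleteSpace E] (h : IsGlobalFlow v φ)
    (hv : ContDiff ℝ ∞ v) (hs : HasCompactSupport v) {K : ℝ≥0} (hK : LipschitzWith K v)
    {p : E × ℝ} (hτ : |p.2| * K < 1) : ContDiffAt ℝ ∞ (fun p : E × ℝ => φ p.1 p.2) p := by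
  lift v to C(E, E) using hv.continuous
  have hF := (contDiff_integralEquationMap v hv hs).contDiffAt (x := (p, h.curve p))
  have hinv := isInvertible_fderiv_integralEquationMap v hv hs hK hτ (h.curve p)
  set g := hF.implicitFunction (by simp) hinv
  have hg : ContDiffAt ℝ ∞ g p := hF.contDiffAt_implicitFunction (by simp) hinv
  have hcont : ContinuousAt (fun q : E × ℝ => |q.2| * (K : ℝ)) p := by fun_prop
  have hev : ∀ᶠ q in 𝓝 p, g q = h.curve q := by
    filter_upwards [hF.eventually_apply_implicitFunction (by simp) hinv,
      hcont.eventually_lt_const hτ] with q hq hq'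
    rw [h.integralEquationMap_curve] at hq
    exact integralEquationMap_unique hK hq' hq (h.integralEquationMap_curve q)
  refine ((ContinuousMap.evalCLM ℝ (1 : I)).contDiff.contDiffAt.comp p hg).congr_of_eventuallyEq ?_
  filter_upwards [hev] with q hq
  simp [hq, IsGlobalFlow.curve]

/-- The flow of a smooth compactly supported vector field is smooth. -/
theorem IsGlobalFlow.contDiff [CompleteSpace E] (h : IsGlobalFlow v φ)
    (hv : ContDiff ℝ ∞ v) (hs : HasCompactSupport v) :
    ContDiff ℝ ∞ (fun p : E × ℝ => φ p.1 p.2) := by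
  obtain ⟨K, hK⟩ := hv.lipschitzWith_of_hasCompactSupport hs (by simp)
  -- The group law removes the smallness of time: a long time is split into `n` equal short steps.
  have key : ∀ (n : ℕ) (p : E × ℝ), |p.2| * K < 1 →
      ContDiffAt ℝ ∞ (fun p : E × ℝ => φ p.1 (n * p.2)) p := by
    intro n
    induction n with
    | zero => intro p _; simpa [(h _).1] using contDiffAt_fst
    | succ n ih =>
      intro p hp
      have e : (fun p : E × ℝ => φ p.1 ((n + 1 : ℕ) * p.2)) =
          fun p => φ (φ p.1 (n * p.2)) p.2 := by
        ext1 q; rw [← h.add hK]; push_cast; ring_nf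
      rw [e]
      exact (h.contDiffAt_of_small hv hs hK (p := (φ p.1 (n * p.2), p.2)) hp).comp p
        ((ih p hp).prodMk contDiffAt_snd)
  refine contDiff_iff_contDiffAt.2 fun p => ?_
  obtain ⟨N, hN⟩ := exists_nat_gt (|p.2| * (K : ℝ))
  have hN0 : (0 : ℝ) < N := lt_of_le_of_lt (by positivity) hN
  have e : (fun p : E × ℝ => φ p.1 p.2) =
      (fun p : E × ℝ => φ p.1 (N * p.2)) ∘ fun p => (p.1, p.2 / N) := by
    ext1 q; simp [mul_div_cancel₀ q.2 hN0.ne']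
  rw [e]
  refine (key N (p.1, p.2 / N) ?_).comp p (by fun_prop)
  rw [abs_div, abs_of_pos hN0, div_mul_eq_mul_div, div_lt_one hN0]
  exact hN

end Flow

/-! ### Diffeomorphisms from local inverses on level sets. -/

section LocalCriteria

set_option linter.unusedSectionVars false

open Filter Topology

variable {E F : Type} [NormedAddCommGroup E] [NormedSpace ℝ E] [FiniteDimensional ℝ E]
  [NormedAddCommGroup F] [NormedSpace ℝ F] [FiniteDimensional ℝ F]
  {α : ℝ} {k : ℕ} {Φ : E → F} {S : Set E} {T : Set F}

theorem LittleHolderOnSet.of_bucAt (hα₀ : 0 < α) (hα₁ : α < 1)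
    (h : ∀ x ∈ S, ∃ g, BucAt k α g x ∧ ∀ᶠ z in 𝓝[S] x, Φ z = g z) : LittleHolderOnSet k α Φ S := by
  intro x hx
  obtain ⟨g, hg, hΦ⟩ := h x hx
  obtain ⟨f, hf, hfg⟩ := hg.exists_isLittleHolder hα₀ hα₁
  have h1 : ∀ᶠ z in 𝓝 x, z ∈ S → Φ z = f z := by
    filter_upwards [eventually_nhdsWithin_iff.1 hΦ, hfg] with z h1 h2 hz
    rw [h1 hz, h2]
  obtain ⟨W, hW, hWo, hxW⟩ := _root_.eventually_nhds_iff.1 h1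
  exact ⟨W, hWo, hxW, f, hf.mono (subset_univ _), fun z hz => hW z hz.2 hz.1⟩

theorem LittleHolderOnSet.bucAt (hα₀ : 0 < α) (hS : IsOpen S) (h : LittleHolderOnSet k α Φ S)
    {x : E} (hx : x ∈ S) : BucAt k α Φ x := by
  obtain ⟨W, hW, hxW, f, hf, hfΦ⟩ := h x hx
  refine (hf.bucAt hα₀ hW hxW).congr ?_
  filter_upwards [hS.mem_nhds hx, hW.mem_nhds hxW] with z h1 h2 using (hfΦ ⟨h1, h2⟩).symm

theorem Set.InjOn.invFunOn_eq {X Y : Type*} [Nonempty X] {Φ : X → Y} {S : Set X}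
    (h : InjOn Φ S) {p : X} (hp : p ∈ S) {x : Y} (hx : Φ p = x) : Function.invFunOn Φ S x = p := by
  rw [← hx]; exact h.leftInvOn_invFunOn hp

/-- A bijection which has local extensions of class `buc^{k+α}` and local inverses with
extensions of class `buc^{k+α}` is a diffeomorphism of this class. -/
theorem isLittleHolderDiffeo_of_local (hα₀ : 0 < α) (hα₁ : α < 1) (hbij : BijOn Φ S T)
    (h1 : ∀ p ∈ S, ∃ g, BucAt k α g p ∧ ∀ᶠ z in 𝓝[S] p, Φ z = g z)
    (h2 : ∀ p ∈ S, ∃ Ψ, BucAt k α Ψ (Φ p) ∧ ∀ᶠ x in 𝓝[T] (Φ p), Ψ x ∈ S ∧ Φ (Ψ x) = x) :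
    IsLittleHolderDiffeo k α Φ S T := by
  refine ⟨hbij, .of_bucAt hα₀ hα₁ h1, Function.invFunOn Φ S, hbij.invOn_invFunOn,
    .of_bucAt hα₀ hα₁ fun x hx => ?_⟩
  obtain ⟨p, hp, rfl⟩ := hbij.surjOn hx
  obtain ⟨Ψ, hΨ, hev⟩ := h2 p hp
  refine ⟨Ψ, hΨ, hev.mono fun z hz => hbij.injOn.invFunOn_eq hz.1 hz.2⟩

/-- Local inverses of a map of a hypersurface times an interval to the ambient space. -/
theorem exists_local_inverse_on_levelSet (hα₀ : 0 < α) (hα₁ : α < 1) {Φ : E × ℝ → E} {f : E → ℝ}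
    {y m : E} {Γ W : Set E} (hΦ : BucAt (k + 1) α Φ (y, 0)) (hf : BucAt (k + 1) α f y)
    (hΦ' : HasFDerivAt Φ (ContinuousLinearMap.fst ℝ E ℝ +
      (ContinuousLinearMap.snd ℝ E ℝ).smulRight m) (y, 0))
    (hm : fderiv ℝ f y m ≠ 0) (hW : IsOpen W) (hyW : y ∈ W)
    (hΓ : Γ ∩ W = {z ∈ W | f z = 0}) :
    ∃ (U : Set (E × ℝ)) (V : Set E) (Ψ : E → E × ℝ), IsOpen U ∧ (y, 0) ∈ U ∧ IsOpen V ∧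
      U ⊆ W ×ˢ univ ∧ (∀ x ∈ V, BucAt (k + 1) α Ψ x ∧ Ψ x ∈ U ∧ (Ψ x).1 ∈ Γ ∧ Φ (Ψ x) = x) ∧
      ∀ p ∈ U, p.1 ∈ Γ → Φ p ∈ V ∧ Ψ (Φ p) = p := by
  have hf0 : ∀ z ∈ W, z ∈ Γ ↔ f z = 0 := fun z hz => by
    have := Set.ext_iff.1 hΓ z
    simpa [hz] using this
  set f' := fderiv ℝ f y
  -- Adding the defining function as a coordinate equalizes the dimensions; points over `Γ` are
  -- those with last coordinate zero, so `x ↦ G⁻¹(x, 0)` is the inverse sought.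
  set G : E × ℝ → E × ℝ := fun p => (Φ p, f p.1)
  have hG : BucAt (k + 1) α G (y, 0) :=
    hΦ.prodMk hα₀ (BucAt.comp (f := Prod.fst) hα₀ hα₁ hf
      (.of_contDiffAt_infty hα₀ hα₁ contDiffAt_fst))
  let A : E × ℝ →L[ℝ] E × ℝ := (ContinuousLinearMap.fst ℝ E ℝ +
      (ContinuousLinearMap.snd ℝ E ℝ).smulRight m).prod (f' ∘L ContinuousLinearMap.fst ℝ E ℝ)
  -- Solving `h + s m = w`, `f' h = c` gives `s = (f' w - c) / f' m` and `h = w - s m`; this is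
  -- where `f' m ≠ 0` enters.
  let B : E × ℝ →L[ℝ] E × ℝ :=
    let s : E × ℝ →L[ℝ] ℝ := (f' m)⁻¹ • (f' ∘L ContinuousLinearMap.fst ℝ E ℝ -
      ContinuousLinearMap.snd ℝ E ℝ)
    (ContinuousLinearMap.fst ℝ E ℝ - s.smulRight m).prod s
  let e' : (E × ℝ) ≃L[ℝ] E × ℝ := ContinuousLinearEquiv.equivOfInverse A B
    (fun p => by
      have h1 : (f' m)⁻¹ * (p.2 * f' m) = p.2 := by field_simp
      ext <;> simp [A, B, h1])
    (fun p => by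
      ext
      · simp [A, B]
      · simp [A, B]; field_simp; ring)
  have hG' : HasFDerivAt G (e' : E × ℝ →L[ℝ] E × ℝ) (y, 0) :=
    hΦ'.prodMk (HasFDerivAt.comp (g := f) (f := Prod.fst) (y, (0 : ℝ))
      hf.differentiableAt.hasFDerivAt hasFDerivAt_fst)
  obtain ⟨e₀, hy, he, hinv⟩ := hG.exists_openPartialHomeomorph hα₀ hα₁ e' hG'
  set e := e₀.restrOpen (W ×ˢ univ) (hW.prod isOpen_univ)
  have heG : ∀ p, e p = G p := fun p => congrFun he p
  have hsource : e.source = e₀.source ∩ W ×ˢ univ := e₀.restrOpen_source _ _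
  have hι : Continuous fun x : E => (x, (0 : ℝ)) := by fun_prop
  refine ⟨e.source, (fun x => (x, (0 : ℝ))) ⁻¹' e.target, fun x => e.symm (x, 0), e.open_source,
    ?_, e.open_target.preimage hι, ?_, fun x hx => ?_, fun p hp hpΓ => ?_⟩
  · rw [hsource]; exact ⟨hy, hyW, trivial⟩
  · rw [hsource]; exact inter_subset_right
  · have hx' : e.symm (x, 0) ∈ e.source := e.map_target hx
    have h1 := e.right_inv hx
    rw [heG] at h1
    have hxW : (e.symm (x, 0)).1 ∈ W := by rw [hsource] at hx'; exact hx'.2.1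
    refine ⟨?_, hx', (hf0 _ hxW).2 (congrArg Prod.snd h1), congrArg Prod.fst h1⟩
    have hx0 : (x, (0 : ℝ)) ∈ e₀.target := hx.1
    exact BucAt.comp (g := e₀.symm) (f := fun x : E => (x, (0 : ℝ))) hα₀ hα₁ (hinv _ hx0)
      (.of_contDiffAt_infty hα₀ hα₁ (by fun_prop))
  · have hpW : p.1 ∈ W := by rw [hsource] at hp; exact hp.2.1
    have h1 : e p = (Φ p, 0) := by rw [heG]; simp [G, (hf0 _ hpW).1 hpΓ]
    refine ⟨?_, ?_⟩
    · change (Φ p, (0 : ℝ)) ∈ e.target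
      rw [← h1]; exact e.map_source hp
    · change e.symm (Φ p, 0) = p
      rw [← h1]; exact e.left_inv hp

end LocalCriteria

/-! ### Tangent and normal vectors of regular level sets. -/

section LevelSets

set_option linter.unusedSectionVars false

open Filter Topology

variable {E : Type} [NormedAddCommGroup E] [InnerProductSpace ℝ E] [CompleteSpace E]
  {f : E → ℝ} {y v : E} {Γ W : Set E}

/-- A vector in the kernel of the derivative is the velocity of a curve in the level set. -/
theorem exists_curve_in_levelSet (hf : ContDiffAt ℝ 1 f y) (hf' : fderiv ℝ f y ≠ 0)
    (hW : W ∈ 𝓝 y) (hyΓ : y ∈ Γ) (hΓ : Γ ∩ W = {z ∈ W | f z = 0}) (hv : fderiv ℝ f y v = 0) :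
    ∃ c : ℝ → E, c 0 = y ∧ HasDerivAt c v 0 ∧ ∀ᶠ t in 𝓝 0, c t ∈ Γ := by
  have hf0 : ∀ z ∈ W, z ∈ Γ ↔ f z = 0 := fun z hz => by
    have := Set.ext_iff.1 hΓ z
    simpa [hz] using this
  set f' := fderiv ℝ f y
  obtain ⟨w, hw⟩ : ∃ w, f' w = 1 := by
    obtain ⟨w, hw⟩ : ∃ w, f' w ≠ 0 := by
      by_contra! h
      exact hf' (ContinuousLinearMap.ext h)
    exact ⟨(f' w)⁻¹ • w, by simp [hw]⟩
  have hfs : HasStrictFDerivAt f f' y := hf.hasStrictFDerivAt one_ne_zero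
  -- This map has derivative the identity at `y` and flattens the level set: `f' (g z - y) = f z`.
  -- The curve is the preimage of the line `y + t v` under it.
  set g : E → E := fun z => z + (f z - f' (z - y)) • w
  have hg : HasStrictFDerivAt g ((ContinuousLinearEquiv.refl ℝ E : E ≃L[ℝ] E) : E →L[ℝ] E) y := by
    have h1 : HasStrictFDerivAt (fun z => f' (z - y)) f' y :=
      f'.hasStrictFDerivAt.comp y ((hasStrictFDerivAt_id y).sub_const y)
    have := (hasStrictFDerivAt_id y).add ((hfs.sub h1).smul_const w)
    convert! this using 1
    ext z; simp
  have hgf : ∀ z, f' (g z - y) = f z := fun z => by simp [g, hw]; ring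
  have hgy : g y = y := by simp [g, (hf0 y (mem_of_mem_nhds hW)).1 hyΓ]
  set h := hg.localInverse g _ y
  have hd : HasStrictFDerivAt h (ContinuousLinearMap.id ℝ E) y := by
    have := hg.to_localInverse
    rw [hgy] at this; exact this
  have hhy : h y = y := by
    have := hg.localInverse_apply_image
    rwa [hgy] at this
  have hr : ∀ᶠ z in 𝓝 y, g (h z) = z := by
    have := hg.eventually_right_inverse
    rwa [hgy] at this
  have hline : HasDerivAt (fun t : ℝ => y + t • v) v 0 := by
    simpa using ((hasDerivAt_id (0 : ℝ)).smul_const v).const_add y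
  have hc : HasDerivAt (fun t : ℝ => h (y + t • v)) v 0 := by
    have hd' : HasFDerivAt h (ContinuousLinearMap.id ℝ E) (y + (0 : ℝ) • v) := by
      simpa using hd.hasFDerivAt
    simpa [Function.comp_def] using hd'.comp_hasDerivAt (0 : ℝ) hline
  have ht : Tendsto (fun t : ℝ => y + t • v) (𝓝 0) (𝓝 y) := by
    simpa using hline.continuousAt.tendsto
  have htc : Tendsto (fun t : ℝ => h (y + t • v)) (𝓝 0) (𝓝 y) := by
    have := hc.continuousAt.tendsto
    simpa [hhy] using this
  refine ⟨fun t => h (y + t • v), by simpa using hhy, hc, ?_⟩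
  filter_upwards [ht.eventually hr, htc.eventually_mem hW] with t h1 h2
  rw [hf0 _ h2, ← hgf, h1]
  simp [hv]

/-- The derivative of a curve in `Γ` with velocity `v` maps tangent cones to tangent cones, and `1`
is tangent at `0` to the parameter set. -/
theorem mem_tangentConeAt_of_fderiv_eq_zero (hf : ContDiffAt ℝ 1 f y) (hf' : fderiv ℝ f y ≠ 0)
    (hW : W ∈ 𝓝 y) (hyΓ : y ∈ Γ) (hΓ : Γ ∩ W = {z ∈ W | f z = 0}) (hv : fderiv ℝ f y v = 0) :
    v ∈ tangentConeAt ℝ Γ y := by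
  obtain ⟨c, hc0, hc, hcΓ⟩ := exists_curve_in_levelSet hf hf' hW hyΓ hΓ hv
  have h1 := (hc.hasFDerivAt.hasFDerivWithinAt (s := {t | c t ∈ Γ})).mapsTo_tangent_cone
  have h2 : (1 : ℝ) ∈ tangentConeAt ℝ {t | c t ∈ Γ} 0 := by
    rw [tangentConeAt_of_mem_nhds hcΓ]; trivial
  have h3 := h1 h2
  rw [hc0] at h3
  have h4 : c '' {t | c t ∈ Γ} ⊆ Γ := by rintro _ ⟨t, ht, rfl⟩; exact ht
  simpa using tangentConeAt_mono h4 h3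

/-- A unit vector orthogonal to the kernel is not in it, so every vector is a kernel vector plus a
multiple of `m`; the normals form a line. -/
theorem eq_inner_smul_of_inner_ker_eq_zero {f' : E →L[ℝ] ℝ} {u m : E}
    (hu : ∀ v, f' v = 0 → inner ℝ u v = 0) (hm : ∀ v, f' v = 0 → inner ℝ m v = 0)
    (hm1 : ‖m‖ = 1) : f' m ≠ 0 ∧ u = inner ℝ u m • m := by
  have h0 : f' m ≠ 0 := fun h => by
    have := hm m h
    rw [real_inner_self_eq_norm_sq, hm1] at this
    norm_num at this
  refine ⟨h0, ext_inner_right ℝ fun v => ?_⟩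
  have hk : f' (v - (f' v / f' m) • m) = 0 := by simp [h0]
  have h1 := hu _ hk
  have h2 := hm _ hk
  rw [inner_sub_right, inner_smul_right, sub_eq_zero] at h1 h2
  rw [real_inner_self_eq_norm_sq, hm1] at h2
  rw [inner_smul_left, h2, h1]
  simp [mul_comm]

/-- The vector from a nearest point of a level set is orthogonal to the level set. -/
theorem inner_eq_zero_of_nearest_point (hf : ContDiffAt ℝ 1 f y) (hf' : fderiv ℝ f y ≠ 0)
    (hW : W ∈ 𝓝 y) (hyΓ : y ∈ Γ) (hΓ : Γ ∩ W = {z ∈ W | f z = 0}) {x : E}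
    (hmin : ∀ z ∈ Γ, dist x y ≤ dist x z) (hv : fderiv ℝ f y v = 0) : inner ℝ (x - y) v = 0 := by
  obtain ⟨c, hc0, hc, hcΓ⟩ := exists_curve_in_levelSet hf hf' hW hyΓ hΓ hv
  have h1 : HasDerivAt (fun t => ‖x - c t‖ ^ 2) (2 * inner ℝ (x - c 0) (-v)) 0 := by
    have := (hc.const_sub x).norm_sq
    exact this
  have h2 : IsLocalMin (fun t => ‖x - c t‖ ^ 2) 0 := by
    filter_upwards [hcΓ] with t ht
    rw [← dist_eq_norm, ← dist_eq_norm, hc0]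
    gcongr
    exact hmin _ ht
  have h3 := h2.hasDerivAt_eq_zero h1
  rw [hc0, inner_neg_right] at h3
  linarith

end LevelSets

/-! ### The tubular neighbourhood theorem in the class `buc^{1+α}`. -/

section TubularNeighbourhood

open Filter Topology

variable {n : ℕ} {α : ℝ} {Γ : Set (EuclideanSpace ℝ (Fin n))}
  {ν : EuclideanSpace ℝ (Fin n) → EuclideanSpace ℝ (Fin n)}

theorem IsUnitNormalField.inner_eq_zero (hν : IsUnitNormalField Γ ν)
    {y : EuclideanSpace ℝ (Fin n)} (hy : y ∈ Γ) {W : Set (EuclideanSpace ℝ (Fin n))}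
    (hW : IsOpen W) (hyW : y ∈ W) {f : EuclideanSpace ℝ (Fin n) → ℝ} (hf : ContDiffAt ℝ 1 f y)
    (hf' : fderiv ℝ f y ≠ 0) (hΓ : Γ ∩ W = {z ∈ W | f z = 0}) {v : EuclideanSpace ℝ (Fin n)}
    (hv : fderiv ℝ f y v = 0) : inner ℝ (ν y) v = 0 :=
  (hν.2 y hy).2 v (mem_tangentConeAt_of_fderiv_eq_zero hf hf' (hW.mem_nhds hyW) hy hΓ hv)

/-- The normalized gradient. -/
noncomputable def unitGradient (f : EuclideanSpace ℝ (Fin n) → ℝ)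
    (z : EuclideanSpace ℝ (Fin n)) : EuclideanSpace ℝ (Fin n) :=
  ‖gradient f z‖⁻¹ • gradient f z

theorem gradient_ne_zero {f : EuclideanSpace ℝ (Fin n) → ℝ} {z : EuclideanSpace ℝ (Fin n)}
    (h : fderiv ℝ f z ≠ 0) : gradient f z ≠ 0 := by
  rw [gradient]; simpa using h

theorem norm_unitGradient {f : EuclideanSpace ℝ (Fin n) → ℝ} {z : EuclideanSpace ℝ (Fin n)}
    (h : fderiv ℝ f z ≠ 0) : ‖unitGradient f z‖ = 1 := by
  rw [unitGradient, norm_smul, norm_inv, norm_norm]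
  exact inv_mul_cancel₀ (norm_ne_zero_iff.2 (gradient_ne_zero h))

theorem inner_unitGradient {f : EuclideanSpace ℝ (Fin n) → ℝ} {z v : EuclideanSpace ℝ (Fin n)}
    (h : fderiv ℝ f z v = 0) : inner ℝ (unitGradient f z) v = 0 := by
  rw [unitGradient, inner_smul_left, gradient, InnerProductSpace.toDual_symm_apply, h, mul_zero]

theorem BucAt.unitGradient (hα₀ : 0 < α) (hα₁ : α < 1) {k : ℕ}
    {f : EuclideanSpace ℝ (Fin n) → ℝ} {z : EuclideanSpace ℝ (Fin n)}
    (hf : BucAt (k + 1) α f z) (hf' : fderiv ℝ f z ≠ 0) : BucAt k α (unitGradient f) z := by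
  have h1 : ContDiff ℝ ∞ fun L : EuclideanSpace ℝ (Fin n) →L[ℝ] ℝ =>
      (InnerProductSpace.toDual ℝ (EuclideanSpace ℝ (Fin n))).symm L :=
    IsBoundedLinearMap.contDiff ⟨⟨map_add _, fun c L => by simp⟩, 1, one_pos,
      fun L => by simp⟩
  have h2 : ContDiffAt ℝ ∞ (fun g : EuclideanSpace ℝ (Fin n) => ‖g‖⁻¹ • g) (gradient f z) :=
    ((contDiffAt_norm ℝ (gradient_ne_zero hf')).inv
      (norm_ne_zero_iff.2 (gradient_ne_zero hf'))).smul contDiffAt_id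
  have h3 : ContDiffAt ℝ ∞ (fun L : EuclideanSpace ℝ (Fin n) →L[ℝ] ℝ =>
      ‖(InnerProductSpace.toDual ℝ (EuclideanSpace ℝ (Fin n))).symm L‖⁻¹ •
      (InnerProductSpace.toDual ℝ (EuclideanSpace ℝ (Fin n))).symm L) (fderiv ℝ f z) :=
    ContDiffAt.comp (g := fun g : EuclideanSpace ℝ (Fin n) => ‖g‖⁻¹ • g) (fderiv ℝ f z) h2
      h1.contDiffAt
  have h4 : ContDiffAt ℝ (k + 1 : ℕ) _ (fderiv ℝ f z) := h3.of_le (by exact_mod_cast le_top)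
  exact BucAt.contDiffAt_comp (f := fderiv ℝ f) hα₀ hα₁ h4 (bucAt_succ_iff.1 hf).2

/-- Locally, a `buc^{2+α}` hypersurface is a regular level set and its unit normal field
extends to a map of class `buc^{1+α}`. -/
theorem exists_local_normal (hα₀ : 0 < α) (hα₁ : α < 1) (hΓ : Γ ∈ hypersurfaces n 2 α)
    (hν : IsUnitNormalField Γ ν) {y : EuclideanSpace ℝ (Fin n)} (hy : y ∈ Γ) :
    ∃ (W : Set (EuclideanSpace ℝ (Fin n))) (f : EuclideanSpace ℝ (Fin n) → ℝ)
      (N : EuclideanSpace ℝ (Fin n) → EuclideanSpace ℝ (Fin n)), IsOpen W ∧ y ∈ W ∧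
      (∀ z ∈ W, BucAt 2 α f z ∧ fderiv ℝ f z ≠ 0 ∧ BucAt 1 α N z) ∧
      Γ ∩ W = {z ∈ W | f z = 0} ∧ ∀ z ∈ Γ ∩ W, ν z = N z ∧ fderiv ℝ f z (ν z) ≠ 0 := by
  obtain ⟨W, hW, hyW, f, hf, hf', hΓW⟩ := hΓ.2.1 y hy
  have hfb : ∀ z ∈ W, BucAt 2 α f z := fun z hz => hf.bucAt hα₀ hW hz
  have hu : ∀ z ∈ W, BucAt 1 α (unitGradient f) z := fun z hz =>
    (hfb z hz).unitGradient hα₀ hα₁ (hf' z hz)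
  have hker : ∀ z ∈ Γ ∩ W, ∀ v, fderiv ℝ f z v = 0 → inner ℝ (ν z) v = 0 := fun z hz v hv =>
    hν.inner_eq_zero hz.1 hW hz.2 ((hfb z hz.2).1.of_le (by simp)) (hf' z hz.2) hΓW hv
  have hνu : ∀ z ∈ Γ ∩ W, ν z = inner ℝ (ν z) (unitGradient f z) • unitGradient f z :=
    fun z hz => (eq_inner_smul_of_inner_ker_eq_zero (hker z hz)
      (fun v hv => inner_unitGradient hv) (norm_unitGradient (hf' z hz.2))).2
  have hne : ∀ z ∈ Γ ∩ W, fderiv ℝ f z (ν z) ≠ 0 := fun z hz =>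
    (eq_inner_smul_of_inner_ker_eq_zero (hker z hz) (hker z hz) (hν.2 z hz.1).1).1
  have habs : ∀ z ∈ Γ ∩ W, |inner ℝ (ν z) (unitGradient f z)| = 1 := fun z hz => by
    have h1 := congrArg norm (hνu z hz)
    rw [norm_smul, norm_unitGradient (hf' z hz.2), (hν.2 z hz.1).1, mul_one] at h1
    exact h1.symm
  set s := inner ℝ (ν y) (unitGradient f y)
  have hcont : ContinuousWithinAt (fun z => inner ℝ (ν z) (unitGradient f z)) Γ y :=
    (hν.1 y hy).inner (𝕜 := ℝ) (hu y hyW).1.continuousAt.continuousWithinAt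
  -- The inner product takes only the values `1` and `-1` on `Γ`, so staying within distance `1` of
  -- `s` forces equality with `s`.
  have hev : ∀ᶠ z in 𝓝 y, z ∈ W ∧ (z ∈ Γ → |inner ℝ (ν z) (unitGradient f z) - s| < 1) := by
    have h1 : ∀ᶠ z in 𝓝 y, z ∈ W := hW.mem_nhds hyW
    exact h1.and (eventually_nhdsWithin_iff.1 (hcont.tendsto.eventually (ball_mem_nhds s one_pos)))
  obtain ⟨W', hW', hW'o, hyW'⟩ := _root_.eventually_nhds_iff.1 hev
  refine ⟨W', f, fun z => s • unitGradient f z, hW'o, hyW', fun z hz => ?_, ?_, fun z hz => ?_⟩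
  · have hzW := (hW' z hz).1
    exact ⟨hfb z hzW, hf' z hzW, (hu z hzW).clm_comp hα₀ (s • ContinuousLinearMap.id ℝ _)⟩
  · ext z
    have h1 := Set.ext_iff.1 hΓW z
    have h2 : z ∈ W' → z ∈ W := fun h => (hW' z h).1
    simp only [mem_inter_iff, mem_ofPred_eq] at h1 ⊢
    tauto
  · have hzW : z ∈ Γ ∩ W := ⟨hz.1, (hW' z hz.2).1⟩
    refine ⟨?_, hne z hzW⟩
    have h1 := (hW' z hz.2).2 hz.1
    have h2 := habs z hzW
    have h3 : |s| = 1 := habs y ⟨hy, hyW⟩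
    have h4 : inner ℝ (ν z) (unitGradient f z) = s := by
      rw [abs_lt] at h1
      rcases (abs_eq zero_le_one).1 h2 with h | h <;>
        rcases (abs_eq zero_le_one).1 h3 with h' | h' <;> linarith
    calc ν z = _ := hνu z hzW
      _ = _ := by rw [h4]

/-- The vector from a nearest point of `Γ` to `x` is normal and shorter than `R`. No smallness of
`R` is needed, only compactness of `Γ`. -/
theorem exists_eq_add_smul_normal (hα₀ : 0 < α) (hα₁ : α < 1) (hΓ : Γ ∈ hypersurfaces n 2 α)
    (hν : IsUnitNormalField Γ ν) {R : ℝ} {x : EuclideanSpace ℝ (Fin n)}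
    (hx : x ∈ thickening R Γ) : ∃ p ∈ Γ ×ˢ Ioo (-R) R, normalMap ν p = x := by
  obtain ⟨z, hz, hxz⟩ := mem_thickening_iff.1 hx
  obtain ⟨y, hy, hxy⟩ := hΓ.1.exists_infDist_eq_dist ⟨z, hz⟩ x
  have hmin : ∀ z ∈ Γ, dist x y ≤ dist x z := fun z hz => by
    rw [← hxy]; exact infDist_le_dist_of_mem hz
  obtain ⟨W, f, N, hW, hyW, hWf, hΓW, -⟩ := exists_local_normal hα₀ hα₁ hΓ hν hy
  obtain ⟨hf, hf', -⟩ := hWf y hyW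
  have hf1 : ContDiffAt ℝ 1 f y := hf.1.of_le (by simp)
  have h1 := (eq_inner_smul_of_inner_ker_eq_zero
    (fun v hv => inner_eq_zero_of_nearest_point hf1 hf' (hW.mem_nhds hyW) hy hΓW hmin hv)
    (fun v hv => hν.inner_eq_zero hy hW hyW hf1 hf' hΓW hv) (hν.2 y hy).1).2
  set s := inner ℝ (x - y) (ν y)
  have h2 : |s| < R := by
    have h3 := congrArg norm h1
    rw [norm_smul, (hν.2 y hy).1, mul_one, ← dist_eq_norm, Real.norm_eq_abs] at h3
    rw [← h3]
    exact (hmin z hz).trans_lt hxz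
  refine ⟨(y, s), ⟨hy, abs_lt.1 h2⟩, ?_⟩
  rw [normalMap, ← h1, add_sub_cancel]

theorem normalMap_mem_thickening (hν : IsUnitNormalField Γ ν) {R : ℝ}
    {p : EuclideanSpace ℝ (Fin n) × ℝ} (hp : p ∈ Γ ×ˢ Ioo (-R) R) :
    normalMap ν p ∈ thickening R Γ := by
  refine mem_thickening_iff.2 ⟨p.1, hp.1, ?_⟩
  rw [dist_eq_norm, normalMap, add_sub_cancel_left, norm_smul, (hν.2 _ hp.1).1, mul_one]
  exact abs_lt.2 hp.2

theorem bucAt_add_smul (hα₀ : 0 < α) (hα₁ : α < 1)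
    {N : EuclideanSpace ℝ (Fin n) → EuclideanSpace ℝ (Fin n)} {k : ℕ}
    {p : EuclideanSpace ℝ (Fin n) × ℝ} (hN : BucAt (k + 1) α N p.1) :
    BucAt (k + 1) α (fun p : EuclideanSpace ℝ (Fin n) × ℝ => p.1 + p.2 • N p.1) p :=
  (BucAt.of_contDiffAt_infty (f := Prod.fst) hα₀ hα₁ contDiffAt_fst).add hα₀
    (BucAt.bilinear hα₀ hα₁ (ContinuousLinearMap.lsmul ℝ ℝ)
      (.of_contDiffAt_infty (f := Prod.snd) hα₀ hα₁ contDiffAt_snd)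
      (BucAt.comp (f := Prod.fst) hα₀ hα₁ hN (.of_contDiffAt_infty hα₀ hα₁ contDiffAt_fst)))

theorem exists_isTubularRadius (hα₀ : 0 < α) (hα₁ : α < 1) (hΓ : Γ ∈ hypersurfaces n 2 α)
    (hν : IsUnitNormalField Γ ν) : ∃ R, IsTubularRadius α Γ ν R := by
  have hloc : ∀ y ∈ Γ, ∃ (U : Set (EuclideanSpace ℝ (Fin n) × ℝ))
      (V : Set (EuclideanSpace ℝ (Fin n)))
      (Ψ : EuclideanSpace ℝ (Fin n) → EuclideanSpace ℝ (Fin n) × ℝ), IsOpen U ∧ (y, 0) ∈ U ∧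
      IsOpen V ∧ (∀ x ∈ V, BucAt 1 α Ψ x ∧ (Ψ x).1 ∈ Γ ∧ normalMap ν (Ψ x) = x) ∧
      (∀ p ∈ U, p.1 ∈ Γ → normalMap ν p ∈ V ∧ Ψ (normalMap ν p) = p) := by
    intro y hy
    obtain ⟨W, f, N, hW, hyW, hWf, hΓW, hνN⟩ := exists_local_normal hα₀ hα₁ hΓ hν hy
    obtain ⟨hf, -, hN⟩ := hWf y hyW
    have hΦ' : HasFDerivAt (fun p : EuclideanSpace ℝ (Fin n) × ℝ => p.1 + p.2 • N p.1)
        (ContinuousLinearMap.fst ℝ (EuclideanSpace ℝ (Fin n)) ℝ +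
        (ContinuousLinearMap.snd ℝ (EuclideanSpace ℝ (Fin n)) ℝ).smulRight (ν y)) (y, 0) := by
      have := (hasFDerivAt_fst (𝕜 := ℝ) (p := (y, (0 : ℝ)))).add
        ((hasFDerivAt_snd (𝕜 := ℝ) (p := (y, (0 : ℝ)))).smul
          (HasFDerivAt.comp (g := N) (f := Prod.fst) (y, (0 : ℝ)) hN.differentiableAt.hasFDerivAt
            hasFDerivAt_fst))
      convert! this using 1
      simp [(hνN y ⟨hy, hyW⟩).1]
    obtain ⟨U, V, Ψ, hU, hyU, hV, hUW, hΨ, hUV⟩ := exists_local_inverse_on_levelSet hα₀ hα₁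
      (bucAt_add_smul (p := (y, 0)) hα₀ hα₁ hN) (hf.of_succ hα₀ hα₁) hΦ' (hνN y ⟨hy, hyW⟩).2
      hW hyW hΓW
    have hnm : ∀ p ∈ U, p.1 ∈ Γ → normalMap ν p = p.1 + p.2 • N p.1 := fun p hp hpΓ => by
      rw [normalMap, (hνN p.1 ⟨hpΓ, (hUW hp).1⟩).1]
    refine ⟨U, V, Ψ, hU, hyU, hV, fun x hx => ?_, fun p hp hpΓ => ?_⟩
    · obtain ⟨h1, h2, h3, h4⟩ := hΨ x hx
      exact ⟨h1, h3, by rw [hnm _ h2 h3, h4]⟩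
    · rw [hnm p hp hpΓ]; exact hUV p hp hpΓ
  choose! U V Ψ hU hyU hV hΨ hUV using hloc
  have hcomp : IsCompact (Γ ×ˢ {(0 : ℝ)}) := hΓ.1.prod isCompact_singleton
  obtain ⟨δ, hδ, hL⟩ := lebesgue_number_lemma_of_metric hcomp
    (c := fun y : Γ => U y) (fun y => hU y y.2) (by
      rintro ⟨y, r⟩ ⟨hy, hr⟩
      rw [mem_singleton_iff] at hr
      dsimp only at hr
      subst hr
      exact mem_iUnion.2 ⟨⟨y, hy⟩, hyU y hy⟩)
  have hL' : ∀ y ∈ Γ, ∃ i ∈ Γ, ball (y, (0 : ℝ)) δ ⊆ U i := fun y hy => by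
    obtain ⟨i, hi⟩ := hL (y, 0) ⟨hy, rfl⟩
    exact ⟨i, i.2, hi⟩
  -- If two points have the same image, their base points differ by at most `|r| + |r'| < 2 δ / 3`,
  -- so both lie in one set `U i`, where the local inverse separates them.
  have hinj : InjOn (normalMap ν) (Γ ×ˢ Ioo (-(δ / 3)) (δ / 3)) := by
    rintro ⟨y, r⟩ ⟨hy, hr⟩ ⟨y', r'⟩ ⟨hy', hr'⟩ h
    have hr1 : |r| < δ / 3 := abs_lt.2 hr
    have hr1' : |r'| < δ / 3 := abs_lt.2 hr'
    have hd : dist y' y < δ := by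
      have h1 : y' - y = r • ν y - r' • ν y' := by
        simp only [normalMap] at h
        rw [sub_eq_sub_iff_add_eq_add, add_comm (r • ν y), h]
      rw [dist_eq_norm, h1]
      refine (norm_sub_le _ _).trans_lt ?_
      rw [norm_smul, norm_smul, (hν.2 y hy).1, (hν.2 y' hy').1, Real.norm_eq_abs, Real.norm_eq_abs]
      linarith
    obtain ⟨i, hi, hball⟩ := hL' y hy
    have h1 : (y, r) ∈ U i := hball (by
      rw [mem_ball, Prod.dist_eq, dist_self, Real.dist_0_eq_abs]; exact max_lt hδ (by linarith))
    have h2 : (y', r') ∈ U i := hball (by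
      rw [mem_ball, Prod.dist_eq, Real.dist_0_eq_abs]; exact max_lt hd (by linarith))
    rw [← (hUV i hi _ h1 hy).2, h, (hUV i hi _ h2 hy').2]
  have hbij : BijOn (normalMap ν) (Γ ×ˢ Ioo (-(δ / 3)) (δ / 3)) (thickening (δ / 3) Γ) :=
    ⟨fun p hp => normalMap_mem_thickening hν hp, hinj,
      fun x hx => exists_eq_add_smul_normal hα₀ hα₁ hΓ hν hx⟩
  refine ⟨δ / 3, by positivity, isLittleHolderDiffeo_of_local hα₀ hα₁ hbij ?_ ?_⟩
  · rintro ⟨y, r⟩ ⟨hy, hr⟩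
    obtain ⟨W, f, N, hW, hyW, hWf, hΓW, hνN⟩ := exists_local_normal hα₀ hα₁ hΓ hν hy
    refine ⟨_, bucAt_add_smul (p := (y, r)) hα₀ hα₁ (hWf y hyW).2.2, ?_⟩
    have hW' : IsOpen (W ×ˢ (univ : Set ℝ)) := hW.prod isOpen_univ
    filter_upwards [self_mem_nhdsWithin,
      mem_nhdsWithin_of_mem_nhds (hW'.mem_nhds (x := (y, r)) ⟨hyW, trivial⟩)] with z hz hzW
    rw [normalMap, (hνN z.1 ⟨hz.1, hzW.1⟩).1]
  · rintro ⟨y, r⟩ ⟨hy, hr⟩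
    obtain ⟨i, hi, hball⟩ := hL' y hy
    have h1 : (y, r) ∈ U i := hball (by
      have hr1 : |r| < δ / 3 := abs_lt.2 hr
      rw [mem_ball, Prod.dist_eq, dist_self, Real.dist_0_eq_abs]; exact max_lt hδ (by linarith))
    obtain ⟨hxV, hΨx⟩ := hUV i hi _ h1 hy
    refine ⟨Ψ i, (hΨ i hi _ hxV).1, mem_nhdsWithin_of_mem_nhds ?_⟩
    have hc : ContinuousAt (fun x => (Ψ i x).2) (normalMap ν (y, r)) :=
      (hΨ i hi _ hxV).1.1.continuousAt.snd
    have hc' : ∀ᶠ x in 𝓝 (normalMap ν (y, r)), (Ψ i x).2 ∈ Ioo (-(δ / 3)) (δ / 3) :=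
      hc.eventually_mem (by rw [hΨx]; exact isOpen_Ioo.mem_nhds hr)
    filter_upwards [hc', (hV i hi).mem_nhds hxV] with x h2 h3
    exact ⟨⟨(hΨ i hi x h3).2.1, h2⟩, (hΨ i hi x h3).2.2⟩

end TubularNeighbourhood

/-! ### Transporting a hypersurface by a transversal flow. -/

section FlowTube

open Filter Topology

variable {n : ℕ} {α : ℝ} {Γ : Set (EuclideanSpace ℝ (Fin n))}
  {ν v : EuclideanSpace ℝ (Fin n) → EuclideanSpace ℝ (Fin n)}

theorem hasFDerivAt_flow_zero {E : Type} [NormedAddCommGroup E] [NormedSpace ℝ E]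
    {v : E → E} {φ : E → ℝ → E} (h : IsGlobalFlow v φ) {y : E}
    (hφ : DifferentiableAt ℝ (fun p : E × ℝ => φ p.1 p.2) (y, 0)) :
    HasFDerivAt (fun p : E × ℝ => φ p.1 p.2) (ContinuousLinearMap.fst ℝ E ℝ +
      (ContinuousLinearMap.snd ℝ E ℝ).smulRight (v y)) (y, 0) := by
  have hA := hφ.hasFDerivAt
  set A := fderiv ℝ (fun p : E × ℝ => φ p.1 p.2) (y, 0)
  have h1 : A ∘L .inl ℝ E ℝ = .id ℝ E := by
    have e1 : HasFDerivAt (fun z => φ z 0) (A ∘L .inl ℝ E ℝ) y :=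
      HasFDerivAt.comp (g := fun p : E × ℝ => φ p.1 p.2) (f := fun z => (z, (0 : ℝ))) y hA
        (hasFDerivAt_prodMk_left y (0 : ℝ))
    refine e1.unique ((hasFDerivAt_id y).congr_of_eventuallyEq ?_)
    exact Eventually.of_forall fun z => (h z).1
  have h2 : A (0, 1) = v y := by
    have e1 : HasDerivAt (fun t => φ y t) (A ((ContinuousLinearMap.inr ℝ E ℝ) 1)) 0 :=
      (HasFDerivAt.comp (g := fun p : E × ℝ => φ p.1 p.2) (f := fun t => (y, t)) (0 : ℝ) hA
        (hasFDerivAt_prodMk_right y (0 : ℝ))).hasDerivAt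
    have e2 := (h y).2 0
    rw [(h y).1] at e2
    simpa using e1.unique e2
  convert! hA using 1
  ext p
  · simpa using (DFunLike.congr_fun h1 p).symm
  · simpa using h2.symm

theorem image_mem_hypersurfaces (hα₀ : 0 < α) (hα₁ : α < 1) (hΓ : Γ ∈ hypersurfaces n 2 α)
    {D D' : EuclideanSpace ℝ (Fin n) → EuclideanSpace ℝ (Fin n)} (hD : ContDiff ℝ ∞ D)
    (hD' : ContDiff ℝ ∞ D') (hl : ∀ x, D' (D x) = x) (hr : ∀ x, D (D' x) = x) :
    D '' Γ ∈ hypersurfaces n 2 α := by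
  have hd : ∀ x, DifferentiableAt ℝ D x := fun x => hD.differentiable (by simp) x
  have hd' : ∀ x, DifferentiableAt ℝ D' x := fun x => hD'.differentiable (by simp) x
  have himg : D' '' (D '' Γ) = Γ := by rw [image_image]; simp [hl]
  have hmem : ∀ x, x ∈ D '' Γ ↔ D' x ∈ Γ := fun x =>
    ⟨by rintro ⟨y, hy, rfl⟩; rwa [hl], fun h => ⟨_, h, hr x⟩⟩
  have hsurj : ∀ x u, ∃ w, fderiv ℝ D' x w = u := fun x u => by
    have h1 : HasFDerivAt (fun y => D' (D y)) (fderiv ℝ D' x ∘L fderiv ℝ D (D' x)) (D' x) := by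
      have h2 : HasFDerivAt D' (fderiv ℝ D' x) (D (D' x)) := by
        rw [hr]; exact (hd' x).hasFDerivAt
      exact h2.comp (D' x) (hd _).hasFDerivAt
    simp only [hl] at h1
    exact ⟨fderiv ℝ D (D' x) u, DFunLike.congr_fun (h1.unique (hasFDerivAt_id _)) u⟩
  refine ⟨hΓ.1.image hD.continuous, fun x hx => ?_, ?_⟩
  · obtain ⟨W, hW, hxW, f, hf, hf', hΓW⟩ := hΓ.2.1 (D' x) ((hmem x).1 hx)
    have hfb : BucAt 2 α (fun z => f (D' z)) x :=
      (hf.bucAt hα₀ hW hxW).comp hα₀ hα₁ (.of_contDiffAt_infty hα₀ hα₁ hD'.contDiffAt)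
    -- The defining function of the image is `f ∘ D'`, replaced near `x` by a globally little Hölder
    -- function with the same germ.
    obtain ⟨g, hg, hgf⟩ := hfb.exists_isLittleHolder hα₀ hα₁
    have hev : ∀ᶠ z in 𝓝 x, g z = f (D' z) ∧ D' z ∈ W :=
      hgf.and (hD'.continuous.continuousAt.eventually_mem (hW.mem_nhds hxW))
    obtain ⟨O, hO, hOo, hxO⟩ := _root_.eventually_nhds_iff.1 hev
    refine ⟨O, hOo, hxO, g, hg.mono (subset_univ _), fun z hz h0 => ?_, ?_⟩
    · have h1 : g =ᶠ[𝓝 z] fun z => f (D' z) := by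
        filter_upwards [hOo.mem_nhds hz] with w hw using (hO w hw).1
      have hfd : DifferentiableAt ℝ f (D' z) :=
        (hf.bucAt hα₀ hW (hO z hz).2).differentiableAt
      have h2 : fderiv ℝ (fun z => f (D' z)) z = fderiv ℝ f (D' z) ∘L fderiv ℝ D' z :=
        (hfd.hasFDerivAt.comp z (hd' z).hasFDerivAt).fderiv
      rw [h1.fderiv_eq, h2] at h0
      refine hf' _ (hO z hz).2 (ContinuousLinearMap.ext fun u => ?_)
      obtain ⟨w, rfl⟩ := hsurj z u
      exact DFunLike.congr_fun h0 w
    · ext z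
      have h1 := Set.ext_iff.1 hΓW (D' z)
      simp only [mem_inter_iff, mem_ofPred_eq, hmem] at h1 ⊢
      constructor
      · rintro ⟨h2, h3⟩
        exact ⟨h3, by rw [(hO z h3).1]; exact (h1.1 ⟨h2, (hO z h3).2⟩).2⟩
      · rintro ⟨h2, h3⟩
        rw [(hO z h2).1] at h3
        exact ⟨(h1.2 ⟨(hO z h2).2, h3⟩).1, h2⟩
  · obtain ⟨ν, hνc, hν⟩ := hΓ.2.2
    -- Normals are pulled back as covectors: the adjoint of `D'` sends `ν` to a field orthogonal to
    -- the tangent cone of the image, nonzero since the derivative of `D'` is onto.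
    set N : EuclideanSpace ℝ (Fin n) → EuclideanSpace ℝ (Fin n) := fun x =>
      ContinuousLinearMap.adjoint (fderiv ℝ D' x) (ν (D' x))
    have hN0 : ∀ x ∈ D '' Γ, N x ≠ 0 := fun x hx h0 => by
      obtain ⟨w, hw⟩ := hsurj x (ν (D' x))
      have h1 : inner ℝ (N x) w = (0 : ℝ) := by rw [h0, inner_zero_left]
      rw [ContinuousLinearMap.adjoint_inner_left, hw, real_inner_self_eq_norm_sq,
        (hν _ ((hmem x).1 hx)).1] at h1
      norm_num at h1
    have hNc : ContinuousOn N (D '' Γ) := by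
      have h1 : Continuous fun x => ContinuousLinearMap.adjoint (fderiv ℝ D' x) :=
        (ContinuousLinearMap.adjoint (𝕜 := ℝ)).continuous.comp (hD'.continuous_fderiv (by simp))
      exact h1.continuousOn.clm_apply
        (hνc.comp hD'.continuous.continuousOn fun x hx => (hmem x).1 hx)
    refine ⟨fun x => ‖N x‖⁻¹ • N x, (hNc.norm.inv₀ fun x hx => norm_ne_zero_iff.2
      (hN0 x hx)).smul hNc, fun x hx => ⟨?_, fun w hw => ?_⟩⟩
    · rw [norm_smul, norm_inv, norm_norm, inv_mul_cancel₀ (norm_ne_zero_iff.2 (hN0 x hx))]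
    · have h1 := ((hd' x).hasFDerivAt.hasFDerivWithinAt (s := D '' Γ)).mapsTo_tangent_cone hw
      rw [himg] at h1
      rw [inner_smul_left, ContinuousLinearMap.adjoint_inner_left,
        (hν _ ((hmem x).1 hx)).2 _ h1, mul_zero]

variable {φ : EuclideanSpace ℝ (Fin n) → ℝ → EuclideanSpace ℝ (Fin n)}

theorem flow_image_mem_hypersurfaces (hφ : IsGlobalFlow v φ) (hv : ContDiff ℝ ∞ v)
    (hs : HasCompactSupport v) (hα₀ : 0 < α) (hα₁ : α < 1) (hΓ : Γ ∈ hypersurfaces n 2 α)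
    (r : ℝ) : (fun y => φ y r) '' Γ ∈ hypersurfaces n 2 α := by
  obtain ⟨K, hK⟩ := hv.lipschitzWith_of_hasCompactSupport hs (by simp)
  have h := hφ.contDiff hv hs
  exact image_mem_hypersurfaces hα₀ hα₁ hΓ (D' := fun y => φ y (-r))
    (h.comp (contDiff_id.prodMk contDiff_const)) (h.comp (contDiff_id.prodMk contDiff_const))
    (fun x => hφ.neg_right hK x r) (fun x => hφ.neg_left hK x r)

theorem exists_local_inverse_flow (hφ : IsGlobalFlow v φ) (hv : ContDiff ℝ ∞ v)
    (hs : HasCompactSupport v) (hα₀ : 0 < α) (hα₁ : α < 1) (hΓ : Γ ∈ hypersurfaces n 2 α)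
    (hν : IsUnitNormalField Γ ν) (htr : ∀ y ∈ Γ, inner ℝ (ν y) (v y) ≠ (0 : ℝ))
    {y : EuclideanSpace ℝ (Fin n)} (hy : y ∈ Γ) (r : ℝ) :
    ∃ Ψ : EuclideanSpace ℝ (Fin n) → EuclideanSpace ℝ (Fin n) × ℝ, BucAt 2 α Ψ (φ y r) ∧
      Ψ (φ y r) = (y, r) ∧ ∀ᶠ x in 𝓝 (φ y r), (Ψ x).1 ∈ Γ ∧ φ (Ψ x).1 (Ψ x).2 = x := by
  obtain ⟨K, hK⟩ := hv.lipschitzWith_of_hasCompactSupport hs (by simp)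
  have hsm := hφ.contDiff hv hs
  obtain ⟨W, f, N, hW, hyW, hWf, hΓW, hνN⟩ := exists_local_normal hα₀ hα₁ hΓ hν hy
  obtain ⟨hf, hf', -⟩ := hWf y hyW
  have hm : fderiv ℝ f y (v y) ≠ 0 := fun h0 =>
    htr y hy (hν.inner_eq_zero hy hW hyW (hf.1.of_le (by simp)) hf' hΓW h0)
  obtain ⟨U, V, Ψ, hU, hyU, hV, hUW, hΨ, hUV⟩ := exists_local_inverse_on_levelSet (k := 1)
    hα₀ hα₁ (.of_contDiffAt_infty hα₀ hα₁ hsm.contDiffAt) hf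
    (hasFDerivAt_flow_zero hφ (hsm.differentiable (by simp) _)) hm hW hyW hΓW
  obtain ⟨hyV, hΨy⟩ := hUV _ hyU hy
  simp only [(hφ y).1] at hyV hΨy
  have hD : ContDiff ℝ ∞ fun x => φ x (-r) := hsm.comp (contDiff_id.prodMk contDiff_const)
  have hDy : φ (φ y r) (-r) = y := hφ.neg_right hK y r
  -- By the group law, the local inverse at time `0` is carried to time `r` by flowing back and
  -- shifting the time coordinate.
  refine ⟨fun x => Ψ (φ x (-r)) + (0, r), ?_, by simp [hDy, hΨy], ?_⟩
  · refine BucAt.add hα₀ ?_ (.of_contDiffAt_infty hα₀ hα₁ contDiffAt_const)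
    refine BucAt.comp (f := fun x => φ x (-r)) hα₀ hα₁ ?_
      (.of_contDiffAt_infty hα₀ hα₁ hD.contDiffAt)
    rw [hDy]
    exact (hΨ y hyV).1
  · have hev : ∀ᶠ x in 𝓝 (φ y r), φ x (-r) ∈ V :=
      hD.continuous.continuousAt.eventually_mem (hV.mem_nhds (by rw [hDy]; exact hyV))
    filter_upwards [hev] with x hx
    obtain ⟨-, -, h1, h2⟩ := hΨ _ hx
    refine ⟨by simpa using h1, ?_⟩
    simp only [Prod.fst_add, Prod.snd_add, add_zero]
    rw [hφ.add hK, h2, hφ.neg_left hK]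

/-- If two orbits meet at times `r` and `r'`, flowing back makes one return to `Γ` after time `r -
r'`, of modulus below `2 r₀`; this is excluded by `hr₀`. The remaining claims are local and come
from transversality. -/
theorem flow_tube (hφ : IsGlobalFlow v φ) (hv : ContDiff ℝ ∞ v)
    (hs : HasCompactSupport v) (hα₀ : 0 < α) (hα₁ : α < 1) (hΓ : Γ ∈ hypersurfaces n 2 α)
    (hν : IsUnitNormalField Γ ν) (htr : ∀ y ∈ Γ, inner ℝ (ν y) (v y) ≠ (0 : ℝ)) {r₀ : ℝ}
    (hr₀ : ∀ y ∈ Γ, ∀ t, |t| < 2 * r₀ → φ y t ∈ Γ → t = 0) :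
    IsOpen (⋃ r ∈ Ioo (-r₀) r₀, (fun y => φ y r) '' Γ) ∧
    (Ioo (-r₀) r₀).PairwiseDisjoint (fun r => (fun y => φ y r) '' Γ) ∧
    IsLittleHolderDiffeo 2 α (fun p : EuclideanSpace ℝ (Fin n) × ℝ => φ p.1 p.2)
      (Γ ×ˢ Ioo (-r₀) r₀) (⋃ r ∈ Ioo (-r₀) r₀, (fun y => φ y r) '' Γ) := by
  obtain ⟨K, hK⟩ := hv.lipschitzWith_of_hasCompactSupport hs (by simp)
  have hinj : ∀ y ∈ Γ, ∀ y' ∈ Γ, ∀ r ∈ Ioo (-r₀) r₀, ∀ r' ∈ Ioo (-r₀) r₀,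
      φ y r = φ y' r' → y = y' ∧ r = r' := by
    intro y hy y' hy' r hr r' hr' h
    have h1 : φ y (r - r') = y' := by
      rw [sub_eq_add_neg, hφ.add hK, h, hφ.neg_right hK]
    have h2 : r - r' = 0 := hr₀ y hy _ (abs_lt.2 ⟨by linarith [hr.1, hr'.2], by
      linarith [hr.2, hr'.1]⟩) (by rwa [h1])
    refine ⟨?_, sub_eq_zero.1 h2⟩
    rw [h2, (hφ y).1] at h1
    exact h1
  have hmem : ∀ x, x ∈ ⋃ r ∈ Ioo (-r₀) r₀, (fun y => φ y r) '' Γ ↔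
      ∃ p ∈ Γ ×ˢ Ioo (-r₀) r₀, φ p.1 p.2 = x := fun x => by
    simp only [mem_iUnion, mem_image, Prod.exists, mem_prod, exists_prop]
    constructor
    · rintro ⟨r, hr, y, hy, h⟩; exact ⟨y, r, ⟨hy, hr⟩, h⟩
    · rintro ⟨y, r, ⟨hy, hr⟩, h⟩; exact ⟨r, hr, y, hy, h⟩
  have hloc : ∀ p ∈ Γ ×ˢ Ioo (-r₀) r₀,
      ∃ Ψ : EuclideanSpace ℝ (Fin n) → EuclideanSpace ℝ (Fin n) × ℝ, BucAt 2 α Ψ (φ p.1 p.2) ∧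
      ∀ᶠ x in 𝓝 (φ p.1 p.2), Ψ x ∈ Γ ×ˢ Ioo (-r₀) r₀ ∧ φ (Ψ x).1 (Ψ x).2 = x := by
    rintro ⟨y, r⟩ ⟨hy, hr⟩
    obtain ⟨Ψ, h1, h2, h3⟩ := exists_local_inverse_flow hφ hv hs hα₀ hα₁ hΓ hν htr hy r
    refine ⟨Ψ, h1, ?_⟩
    have hc : ∀ᶠ x in 𝓝 (φ y r), (Ψ x).2 ∈ Ioo (-r₀) r₀ :=
      h1.1.continuousAt.snd.eventually_mem (by rw [h2]; exact isOpen_Ioo.mem_nhds hr)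
    filter_upwards [hc, h3] with x h4 h5
    exact ⟨⟨h5.1, h4⟩, h5.2⟩
  refine ⟨?_, ?_, isLittleHolderDiffeo_of_local hα₀ hα₁ ⟨?_, ?_, ?_⟩ ?_ ?_⟩
  · refine isOpen_iff_mem_nhds.2 fun x hx => ?_
    obtain ⟨p, hp, rfl⟩ := (hmem x).1 hx
    obtain ⟨Ψ, -, h⟩ := hloc p hp
    exact mem_of_superset h fun x hx => (hmem x).2 ⟨_, hx.1, hx.2⟩
  · intro r hr r' hr' hne
    refine Set.disjoint_left.2 ?_
    rintro _ ⟨y, hy, rfl⟩ ⟨y', hy', h⟩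
    exact hne (hinj y hy y' hy' r hr r' hr' h.symm).2
  · exact fun p hp => (hmem _).2 ⟨p, hp, rfl⟩
  · intro p hp q hq h
    have := hinj _ hp.1 _ hq.1 _ hp.2 _ hq.2 h
    exact Prod.ext this.1 this.2
  · exact fun x hx => (hmem x).1 hx
  · exact fun p _ => ⟨_, .of_contDiffAt_infty hα₀ hα₁ (hφ.contDiff hv hs).contDiffAt,
      Eventually.of_forall fun _ => rfl⟩
  · intro p hp
    obtain ⟨Ψ, h1, h2⟩ := hloc p hp
    exact ⟨Ψ, h1, mem_nhdsWithin_of_mem_nhds h2⟩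

end FlowTube

/-! ### The cut-off normal field and its mollification. -/

section RegularizedNormal

open Filter Topology

variable {n : ℕ} {α R : ℝ} {Γ : Set (EuclideanSpace ℝ (Fin n))}
  {ν : EuclideanSpace ℝ (Fin n) → EuclideanSpace ℝ (Fin n)} {η : ℝ → ℝ}
  {ψ : EuclideanSpace ℝ (Fin n) → ℝ}

theorem IsTubularRadius.tubeCoord_normalMap (hR : IsTubularRadius α Γ ν R)
    {p : EuclideanSpace ℝ (Fin n) × ℝ} (hp : p ∈ Γ ×ˢ Ioo (-R) R) :
    tubeCoord Γ ν R (normalMap ν p) = p :=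
  hR.2.1.injOn.invFunOn_eq hp rfl

theorem IsTubularRadius.tubeCoord_mem (hR : IsTubularRadius α Γ ν R)
    {x : EuclideanSpace ℝ (Fin n)} (hx : x ∈ thickening R Γ) :
    tubeCoord Γ ν R x ∈ Γ ×ˢ Ioo (-R) R ∧ normalMap ν (tubeCoord Γ ν R x) = x := by
  obtain ⟨p, hp, rfl⟩ := hR.2.1.surjOn hx
  rw [hR.tubeCoord_normalMap hp]
  exact ⟨hp, rfl⟩

theorem IsTubularRadius.tubeCoord_of_mem (hR : IsTubularRadius α Γ ν R)
    {y : EuclideanSpace ℝ (Fin n)} (hy : y ∈ Γ) : tubeCoord Γ ν R y = (y, 0) := by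
  have := hR.tubeCoord_normalMap (p := (y, 0)) ⟨hy, by simp [hR.1]⟩
  simpa [normalMap] using this

theorem IsTubularRadius.contDiffAt_tubeCoord (hα₀ : 0 < α) (hR : IsTubularRadius α Γ ν R)
    {x : EuclideanSpace ℝ (Fin n)} (hx : x ∈ thickening R Γ) :
    ContDiffAt ℝ 1 (tubeCoord Γ ν R) x := by
  obtain ⟨-, hbij, -, Ψ, hΨ, hΨs⟩ := hR
  refine (hΨs.bucAt hα₀ isOpen_thickening hx).1.congr_of_eventuallyEq ?_
  filter_upwards [isOpen_thickening.mem_nhds hx] with z hz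
  obtain ⟨p, hp, rfl⟩ := hbij.surjOn hz
  rw [hΨ.1 hp]
  exact hbij.injOn.invFunOn_eq hp rfl

theorem isCompact_image_normalMap (hΓ : IsCompact Γ) (hν : ContinuousOn ν Γ) (a b : ℝ) :
    IsCompact (normalMap ν '' (Γ ×ˢ Icc a b)) := by
  refine (hΓ.prod isCompact_Icc).image_of_continuousOn ?_
  exact continuousOn_fst.add (continuousOn_snd.smul
    (hν.comp continuousOn_fst fun p hp => hp.1))

theorem cutoffNormal_of_mem {x : EuclideanSpace ℝ (Fin n)} (hx : x ∈ thickening R Γ) :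
    cutoffNormal Γ ν R η x = η (tubeCoord Γ ν R x).2 • ν (tubeCoord Γ ν R x).1 := if_pos hx

theorem cutoffNormal_eq_zero (hR : IsTubularRadius α Γ ν R) (hη : IsCutoff R η)
    {x : EuclideanSpace ℝ (Fin n)}
    (hx : x ∉ normalMap ν '' (Γ ×ˢ Icc (-(3 * R / 4)) (3 * R / 4))) :
    cutoffNormal Γ ν R η x = 0 := by
  by_cases hxT : x ∈ thickening R Γ
  · obtain ⟨h1, h2⟩ := hR.tubeCoord_mem hxT
    rw [cutoffNormal_of_mem hxT, hη.eq_zero, zero_smul]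
    exact fun h => hx ⟨_, ⟨h1.1, Ioo_subset_Icc_self h⟩, h2⟩
  · exact if_neg hxT

theorem image_normalMap_subset_thickening (hR : IsTubularRadius α Γ ν R) :
    normalMap ν '' (Γ ×ˢ Icc (-(3 * R / 4)) (3 * R / 4)) ⊆ thickening R Γ := by
  rintro _ ⟨p, hp, rfl⟩
  have := hR.1
  exact hR.2.1.mapsTo ⟨hp.1, by linarith [hp.2.1], by linarith [hp.2.2]⟩

theorem hasCompactSupport_cutoffNormal (hΓ : IsCompact Γ) (hν : IsUnitNormalField Γ ν)
    (hR : IsTubularRadius α Γ ν R) (hη : IsCutoff R η) :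
    HasCompactSupport (cutoffNormal Γ ν R η) :=
  .intro (isCompact_image_normalMap hΓ hν.1 _ _) fun _ hx => cutoffNormal_eq_zero hR hη hx

theorem continuous_cutoffNormal (hα₀ : 0 < α) (hΓ : IsCompact Γ) (hν : IsUnitNormalField Γ ν)
    (hR : IsTubularRadius α Γ ν R) (hη : IsCutoff R η) : Continuous (cutoffNormal Γ ν R η) := by
  refine continuous_iff_continuousAt.2 fun x => ?_
  by_cases hxT : x ∈ thickening R Γ
  · have hc : ContinuousOn (tubeCoord Γ ν R) (thickening R Γ) := fun z hz =>
      (hR.contDiffAt_tubeCoord hα₀ hz).continuousAt.continuousWithinAt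
    have h1 : ContinuousOn (fun x => η (tubeCoord Γ ν R x).2 • ν (tubeCoord Γ ν R x).1)
        (thickening R Γ) :=
      (hη.smooth.continuous.comp_continuousOn hc.snd).smul
        (hν.1.comp hc.fst fun z hz => (hR.tubeCoord_mem hz).1.1)
    have h2 : ContinuousOn (cutoffNormal Γ ν R η) (thickening R Γ) :=
      h1.congr fun z hz => cutoffNormal_of_mem hz
    exact h2.continuousAt (isOpen_thickening.mem_nhds hxT)
  · have hK := (isCompact_image_normalMap hΓ hν.1 (-(3 * R / 4)) (3 * R / 4)).isClosed
    have hx : x ∉ normalMap ν '' (Γ ×ˢ Icc (-(3 * R / 4)) (3 * R / 4)) := fun h =>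
      hxT (image_normalMap_subset_thickening hR h)
    refine (continuousAt_const (y := 0)).congr ?_
    filter_upwards [hK.isOpen_compl.mem_nhds hx] with z hz
    exact (cutoffNormal_eq_zero hR hη hz).symm

theorem norm_cutoffNormal_le (hν : IsUnitNormalField Γ ν) (hR : IsTubularRadius α Γ ν R)
    (hη : IsCutoff R η) (x : EuclideanSpace ℝ (Fin n)) : ‖cutoffNormal Γ ν R η x‖ ≤ 1 := by
  by_cases hxT : x ∈ thickening R Γ
  · rw [cutoffNormal_of_mem hxT, norm_smul, (hν.2 _ (hR.tubeCoord_mem hxT).1.1).1, mul_one,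
      Real.norm_of_nonneg (hη.nonneg _)]
    exact hη.le_one _
  · rw [cutoffNormal, if_neg hxT, norm_zero]; exact zero_le_one

/-- Where the cut-off equals `1` the field is the velocity of the normal line `s ↦ y + s ν(y)`,
along which the normal coordinate is `s`. -/
theorem fderiv_tubeCoord_cutoffNormal (hα₀ : 0 < α) (hR : IsTubularRadius α Γ ν R)
    (hη : IsCutoff R η) {x : EuclideanSpace ℝ (Fin n)} (hx : x ∈ thickening R Γ)
    (hx2 : |(tubeCoord Γ ν R x).2| < R / 2) :
    fderiv ℝ (fun z => (tubeCoord Γ ν R z).2) x (cutoffNormal Γ ν R η x) = 1 := by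
  obtain ⟨h1, h2⟩ := hR.tubeCoord_mem hx
  set y := (tubeCoord Γ ν R x).1
  set r := (tubeCoord Γ ν R x).2
  have hw : cutoffNormal Γ ν R η x = ν y := by
    rw [cutoffNormal_of_mem hx, hη.eq_one _ ⟨(abs_lt.1 hx2).1.le, (abs_lt.1 hx2).2.le⟩, one_smul]
  have hxc : y + r • ν y = x := h2
  have hd : HasFDerivAt (fun z => (tubeCoord Γ ν R z).2)
      (fderiv ℝ (fun z => (tubeCoord Γ ν R z).2) x) (y + r • ν y) := by
    rw [hxc]
    exact ((hR.contDiffAt_tubeCoord hα₀ hx).snd.differentiableAt one_ne_zero).hasFDerivAt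
  have hc : HasDerivAt (fun s : ℝ => y + s • ν y) (ν y) r := by
    simpa using ((hasDerivAt_id r).smul_const (ν y)).const_add y
  have h3 := hd.comp_hasDerivAt r hc
  rw [hw]
  refine h3.unique ((hasDerivAt_id r).congr_of_eventuallyEq ?_)
  filter_upwards [isOpen_Ioo.mem_nhds h1.2] with s hs
  exact congrArg Prod.snd (hR.tubeCoord_normalMap (p := (y, s)) ⟨h1.1, hs⟩)

theorem contDiff_rescale (hψ : IsMollifier ψ) (δ : ℝ) : ContDiff ℝ ∞ (rescale ψ δ) :=
  contDiff_const.mul (hψ.smooth.comp (contDiff_const_smul δ⁻¹))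

theorem rescale_nonneg (hψ : IsMollifier ψ) {δ : ℝ} (hδ : 0 < δ) (x : EuclideanSpace ℝ (Fin n)) :
    0 ≤ rescale ψ δ x :=
  mul_nonneg (by positivity) (hψ.nonneg _)

theorem integral_rescale (hψ : IsMollifier ψ) {δ : ℝ} (hδ : 0 < δ) : ∫ x, rescale ψ δ x = 1 := by
  simp only [rescale]
  rw [integral_const_mul, Measure.integral_comp_inv_smul, hψ.integral_eq_one,
    finrank_euclideanSpace_fin, abs_of_pos (by positivity), smul_eq_mul, mul_one]
  exact inv_mul_cancel₀ (by positivity)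

theorem exists_support_rescale_subset (hψ : IsMollifier ψ) :
    ∃ M > 0, ∀ δ > 0, Function.support (rescale ψ δ) ⊆ ball 0 (δ * M) := by
  obtain ⟨M, hM⟩ := hψ.compactSupport.isCompact.isBounded.subset_ball 0
  refine ⟨max M 1, by positivity, fun δ hδ x hx => ?_⟩
  have h1 : ψ (δ⁻¹ • x) ≠ 0 := right_ne_zero_of_mul hx
  have h2 := hM (subset_tsupport ψ h1)
  rw [mem_ball_zero_iff, norm_smul, norm_inv, Real.norm_of_nonneg hδ.le,
    inv_mul_lt_iff₀ hδ] at h2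
  rw [mem_ball_zero_iff]
  exact h2.trans_le (by gcongr; exact le_max_left _ _)

theorem hasCompactSupport_rescale (hψ : IsMollifier ψ) {δ : ℝ} (hδ : 0 < δ) :
    HasCompactSupport (rescale ψ δ) := by
  obtain ⟨M, -, hM⟩ := exists_support_rescale_subset hψ
  exact .of_support_subset_isCompact (isCompact_closedBall 0 (δ * M))
    ((hM δ hδ).trans ball_subset_closedBall)

theorem regularizedNormal_props (hα₀ : 0 < α) (hΓ : IsCompact Γ) (hν : IsUnitNormalField Γ ν)
    (hR : IsTubularRadius α Γ ν R) (hη : IsCutoff R η) (hψ : IsMollifier ψ) {ε : ℝ}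
    (hε : 0 < ε) :
    ∃ δ₀ > 0, ∀ δ, 0 < δ → δ < δ₀ → ContDiff ℝ ∞ (regularizedNormal Γ ν R η ψ δ) ∧
      HasCompactSupport (regularizedNormal Γ ν R η ψ δ) ∧
      tsupport (regularizedNormal Γ ν R η ψ δ) ⊆ thickening R Γ ∧
      (∀ x, ‖regularizedNormal Γ ν R η ψ δ x‖ ≤ 1) ∧
      ∀ x, ‖regularizedNormal Γ ν R η ψ δ x - cutoffNormal Γ ν R η x‖ ≤ ε := by
  have hwc := continuous_cutoffNormal hα₀ hΓ hν hR hη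
  have hws := hasCompactSupport_cutoffNormal hΓ hν hR hη
  obtain ⟨M, hM0, hM⟩ := exists_support_rescale_subset hψ
  have hK := isCompact_image_normalMap hΓ hν.1 (-(3 * R / 4)) (3 * R / 4)
  set K := normalMap ν '' (Γ ×ˢ Icc (-(3 * R / 4)) (3 * R / 4))
  obtain ⟨a, ha, haK⟩ := hK.exists_cthickening_subset_open isOpen_thickening
    (image_normalMap_subset_thickening hR)
  obtain ⟨b, hb, hbw⟩ := Metric.uniformContinuous_iff.1
    (hws.uniformContinuous_of_continuous hwc) ε hε
  -- The mollifier has support of radius `δ M`: below `a` it keeps the support inside the tube,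
  -- below `b` it keeps the error within `ε` by uniform continuity.
  refine ⟨min a b / M, by positivity, fun δ hδ hδ₀ => ?_⟩
  rw [lt_div_iff₀ hM0, lt_min_iff] at hδ₀
  refine ⟨?_, ?_, ?_, fun x => ?_, fun x => ?_⟩
  · exact (hasCompactSupport_rescale hψ hδ).contDiff_convolution_left _ (contDiff_rescale hψ δ)
      hwc.locallyIntegrable
  · exact (hasCompactSupport_rescale hψ hδ).convolution _ hws
  · refine (closure_minimal ?_ isClosed_cthickening).trans haK
    refine (support_convolution_subset (ContinuousLinearMap.lsmul ℝ ℝ)).trans ?_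
    rintro _ ⟨s, hs, t, ht, rfl⟩
    have htK : t ∈ K := by
      by_contra h
      exact ht (cutoffNormal_eq_zero hR hη h)
    have hs' := hM δ hδ hs
    rw [mem_ball_zero_iff] at hs'
    refine mem_cthickening_of_dist_le _ t a K htK ?_
    simpa using (hs'.trans hδ₀.1).le
  · have := dist_convolution_le (μ := volume) (x₀ := x) (z₀ := 0) zero_le_one (hM δ hδ)
      (rescale_nonneg hψ hδ) (integral_rescale hψ hδ) hwc.aestronglyMeasurable
      fun z _ => by simpa using norm_cutoffNormal_le hν hR hη z
    simpa using! this
  · rw [← dist_eq_norm]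
    exact dist_convolution_le (μ := volume) hε.le (hM δ hδ)
      (rescale_nonneg hψ hδ) (integral_rescale hψ hδ) hwc.aestronglyMeasurable
      fun z hz => (hbw (lt_trans hz hδ₀.2)).le

theorem IsGlobalFlow.norm_sub_le {E : Type} [NormedAddCommGroup E] [NormedSpace ℝ E] {v : E → E}
    {φ : E → ℝ → E} (h : IsGlobalFlow v φ) (hv : ∀ x, ‖v x‖ ≤ 1) (y : E) (t : ℝ) :
    ‖φ y t - y‖ ≤ |t| := by
  have := convex_univ.norm_image_sub_le_of_norm_hasDerivWithin_le (f := φ y) (C := 1)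
    (fun s _ => ((h y).2 s).hasDerivWithinAt) (fun s _ => hv _) (mem_univ 0) (mem_univ t)
  simpa [(h y).1] using this

/-- Compactness gives a closed neighbourhood of `Γ` on which the cut-off is inactive and the normal
coordinate has bounded gradient. Its size does not involve the mollification. -/
theorem exists_radius_bound (hα₀ : 0 < α) (hΓ : IsCompact Γ) (hR : IsTubularRadius α Γ ν R) :
    ∃ ε > 0, ∃ M > 0, ∀ x ∈ cthickening ε Γ, x ∈ thickening R Γ ∧
      |(tubeCoord Γ ν R x).2| < R / 2 ∧ ‖fderiv ℝ (fun z => (tubeCoord Γ ν R z).2) x‖ ≤ M := by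
  have hρ : ∀ x ∈ thickening R Γ, ContDiffAt ℝ 1 (fun z => (tubeCoord Γ ν R z).2) x :=
    fun x hx => (hR.contDiffAt_tubeCoord hα₀ hx).snd
  have hO : IsOpen (thickening R Γ ∩ (fun x => |(tubeCoord Γ ν R x).2|) ⁻¹' Iio (R / 2)) :=
    ContinuousOn.isOpen_inter_preimage
      (fun x hx => (hρ x hx).continuousAt.abs.continuousWithinAt) isOpen_thickening isOpen_Iio
  obtain ⟨ε, hε, hεO⟩ := hΓ.exists_cthickening_subset_open hO fun y hy =>
    ⟨self_subset_thickening hR.1 _ hy, by simp [hR.tubeCoord_of_mem hy, hR.1]⟩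
  have hc : ContinuousOn (fderiv ℝ (fun z => (tubeCoord Γ ν R z).2)) (cthickening ε Γ) :=
    fun x hx => ((hρ x (hεO hx).1).fderiv_right (m := 0) (by simp)).continuousAt.continuousWithinAt
  obtain ⟨M, hM⟩ := (hΓ.cthickening (r := ε)).exists_bound_of_continuousOn hc
  exact ⟨ε, hε, max M 1, by positivity, fun x hx =>
    ⟨(hεO hx).1, (hεO hx).2, (hM x hx).trans (le_max_left _ _)⟩⟩

end RegularizedNormal

theorem mainTheorem7 (n : ℕ) (α : ℝ) (hα₀ : 0 < α) (hα₁ : α < 1)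
    (Γ₀ : Set (EuclideanSpace ℝ (Fin n))) (hΓ₀ : Γ₀ ∈ hypersurfaces n 2 α)
    (ν : EuclideanSpace ℝ (Fin n) → EuclideanSpace ℝ (Fin n)) (hν : IsUnitNormalField Γ₀ ν) :
    (∃ R, IsTubularRadius α Γ₀ ν R) ∧
    ∀ (R : ℝ) (η : ℝ → ℝ) (ψ : EuclideanSpace ℝ (Fin n) → ℝ),
      IsTubularRadius α Γ₀ ν R → IsCutoff R η → IsMollifier ψ →
      ∃ r₀ > 0, ∃ δ₀ > 0, ∀ δ, 0 < δ → δ < δ₀ →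
        ContDiff ℝ ∞ (regularizedNormal Γ₀ ν R η ψ δ) ∧
        HasCompactSupport (regularizedNormal Γ₀ ν R η ψ δ) ∧
        tsupport (regularizedNormal Γ₀ ν R η ψ δ) ⊆ thickening R Γ₀ ∧
        ∃ φ : EuclideanSpace ℝ (Fin n) → ℝ → EuclideanSpace ℝ (Fin n),
          IsFlowOf (regularizedNormal Γ₀ ν R η ψ δ) φ ∧
          (∀ r, |r| ≤ r₀ → (fun y => φ y r) '' Γ₀ ⊆ thickening R Γ₀) ∧
          (∀ r, |r| < r₀ → (fun y => φ y r) '' Γ₀ ∈ hypersurfaces n 2 α) ∧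
          IsOpen (⋃ r ∈ Ioo (-r₀) r₀, (fun y => φ y r) '' Γ₀) ∧
          Γ₀ ⊆ ⋃ r ∈ Ioo (-r₀) r₀, (fun y => φ y r) '' Γ₀ ∧
          (Ioo (-r₀) r₀).PairwiseDisjoint (fun r => (fun y => φ y r) '' Γ₀) ∧
          IsLittleHolderDiffeo 2 α (fun p : EuclideanSpace ℝ (Fin n) × ℝ => φ p.1 p.2)
            (Γ₀ ×ˢ Ioo (-r₀) r₀) (⋃ r ∈ Ioo (-r₀) r₀, (fun y => φ y r) '' Γ₀) := by
  refine ⟨exists_isTubularRadius hα₀ hα₁ hΓ₀ hν, fun R η ψ hR hη hψ => ?_⟩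
  obtain ⟨ε, hε, M, hM0, hM⟩ := exists_radius_bound hα₀ hΓ₀.1 hR
  -- The error `1 / 2` ensures transversality on `Γ₀`; the error `1 / (2 * M)` changes the unit
  -- growth rate of the normal coordinate by at most `1 / 2`.
  obtain ⟨δ₀, hδ₀, hδ⟩ := regularizedNormal_props hα₀ hΓ₀.1 hν hR hη hψ
    (ε := min (1 / 2) (1 / (2 * M))) (by positivity)
  -- Differences of two times in `(-r₀, r₀)` are then below `ε`, and orbits of speed at most `1`
  -- stay within `ε` of `Γ₀` for such times.
  refine ⟨ε / 2, by positivity, δ₀, hδ₀, fun δ h0 h1 => ?_⟩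
  obtain ⟨hv, hs, hsupp, hv1, hvw⟩ := hδ δ h0 h1
  set v := regularizedNormal Γ₀ ν R η ψ δ
  obtain ⟨K, hK⟩ := hv.lipschitzWith_of_hasCompactSupport hs (by simp)
  obtain ⟨φ, hφ⟩ := exists_isGlobalFlow (M := 1) hK (by simpa using hv1)
  have hnear : ∀ y ∈ Γ₀, ∀ t, |t| ≤ ε → φ y t ∈ cthickening ε Γ₀ := fun y hy t ht =>
    mem_cthickening_of_dist_le _ y ε Γ₀ hy
      (by rw [dist_eq_norm]; exact (hφ.norm_sub_le hv1 y t).trans ht)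
  have htr : ∀ y ∈ Γ₀, inner ℝ (ν y) (v y) ≠ (0 : ℝ) := fun y hy h => by
    have h2 : cutoffNormal Γ₀ ν R η y = ν y := by
      rw [cutoffNormal_of_mem (self_subset_thickening hR.1 _ hy), hR.tubeCoord_of_mem hy,
        hη.eq_one 0 (by constructor <;> linarith [hR.1]), one_smul]
    have h3 : inner ℝ (ν y) (v y - ν y) = -(1 : ℝ) := by
      rw [inner_sub_right, h, real_inner_self_eq_norm_sq, (hν.2 y hy).1]; norm_num
    have h4 := abs_real_inner_le_norm (ν y) (v y - ν y)
    have h5 := hvw y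
    rw [h2] at h5
    rw [h3, (hν.2 y hy).1, abs_neg, abs_one, one_mul] at h4
    linarith [min_le_left (1 / 2 : ℝ) (1 / (2 * M))]
  -- The normal coordinate vanishes on `Γ₀` and increases strictly along the orbit for `|t| ≤ ε`, so
  -- it is zero only at `t = 0`.
  have hret : ∀ y ∈ Γ₀, ∀ t, |t| < 2 * (ε / 2) → φ y t ∈ Γ₀ → t = 0 := by
    intro y hy t ht hty
    set ρ : EuclideanSpace ℝ (Fin n) → ℝ := fun z => (tubeCoord Γ₀ ν R z).2
    have hder : ∀ s ∈ Icc (-ε) ε,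
        HasDerivAt (fun s => ρ (φ y s)) (fderiv ℝ ρ (φ y s) (v (φ y s))) s := fun s hs => by
      have h2 := hM _ (hnear y hy s (abs_le.2 hs))
      have h3 : DifferentiableAt ℝ ρ (φ y s) :=
        (hR.contDiffAt_tubeCoord hα₀ h2.1).snd.differentiableAt one_ne_zero
      exact h3.hasFDerivAt.comp_hasDerivAt s ((hφ y).2 s)
    have hpos : ∀ s ∈ Icc (-ε) ε, 0 < fderiv ℝ ρ (φ y s) (v (φ y s)) := fun s hs => by
      obtain ⟨h2, h3, h4⟩ := hM _ (hnear y hy s (abs_le.2 hs))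
      have h5 := fderiv_tubeCoord_cutoffNormal hα₀ hR hη h2 h3
      have h6 : |fderiv ℝ ρ (φ y s) (v (φ y s) - cutoffNormal Γ₀ ν R η (φ y s))| ≤
          M * (1 / (2 * M)) :=
        (fderiv ℝ ρ (φ y s)).le_of_opNorm_le_of_le h4 ((hvw _).trans (min_le_right _ _))
      have h7 : M * (1 / (2 * M)) = 1 / 2 := by field_simp
      rw [map_sub, h5, h7] at h6
      linarith [(abs_le.1 h6).1]
    have hmono : StrictMonoOn (fun s => ρ (φ y s)) (Icc (-ε) ε) := by
      refine strictMonoOn_of_deriv_pos (convex_Icc _ _)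
        (fun s hs => (hder s hs).continuousAt.continuousWithinAt) fun s hs => ?_
      rw [interior_Icc] at hs
      rw [(hder s (Ioo_subset_Icc_self hs)).deriv]
      exact hpos s (Ioo_subset_Icc_self hs)
    have h0 : ∀ z ∈ Γ₀, ρ z = 0 := fun z hz => congrArg Prod.snd (hR.tubeCoord_of_mem hz)
    refine hmono.injOn (abs_le.1 (by linarith)) ⟨by linarith, by linarith⟩ ?_
    simp only [h0 _ hty, (hφ y).1, h0 y hy]
  obtain ⟨h2, h3, h4⟩ := flow_tube hφ hv hs hα₀ hα₁ hΓ₀ hν htr hret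
  refine ⟨hv, hs, hsupp, φ, hφ, ?_, fun r _ => flow_image_mem_hypersurfaces hφ hv hs hα₀ hα₁ hΓ₀ r,
    h2, fun y hy => ?_, h3, h4⟩
  · rintro r hr _ ⟨y, hy, rfl⟩
    exact (hM _ (hnear y hy r (by linarith))).1
  · exact mem_biUnion (x := (0 : ℝ)) (by constructor <;> linarith) ⟨y, hy, (hφ y).1⟩
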